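/- Let $G$ be a locally compact (Hausdorff) group with a fixed left Haar measure, and let $2\le p\le\infty$, with conjugate exponent $q$, $\frac1p+\frac1q=1$. View $L^1(G)$ as a Banach $*$-algebra under convolution and its usual involution. For $1\le r\le\infty$ let $\lambda_r(f)g=f*g$ for $f\in L^1(G)$, $g\in L^r(G)$, and let $\mathrm{PF}_p^*(G)$ be the Banach $*$-algebra obtained by completing $L^1(G)$ in the norm $$\|f\|_{\mathrm{PF}_p^*(G)}=\max\{\|\lambda_p(f)\|_{B(L^p(G))},\ \|\lambda_q(f)\|_{B(L^q(G))}\}.$$ A (strongly continuous) unitary representation $\pi:G\to B(H_\pi)$ is an $L^p$-representation if $H_\pi$ has a dense subspace $H_0$ such that $s\mapsto\langle\pi(s)\xi,\xi\rangle$ belongs to $L^p(G)$ for every $\xi\in H_0$. Let $C^*_{L^p}(G)$ be the $C^*$-algebra obtained by completing $L^1(G)$ in the norm $$\|f\|_{C^*_{L^p}(G)}=\sup\{\|\pi(f)\| : \pi\text{ is an }L^p\text{-representation of }G\},\qquad \pi(f)=\int_G f(s)\pi(s)\,ds .$$ For a Banach $*$-algebra $B$, let $C^*(B)$ be its enveloping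 $C^*$-algebra, i.e. the Hausdorff completion of $B$ in the seminorm $b\mapsto\sup\{\|\pi(b)\|:\pi\text{ is a }*\text{-representation of }B\text{ on a Hilbert space}\}$. Then the identity map on $L^1(G)$ extends to a contractive $*$-homomorphism $\mathrm{PF}_p^*(G)\to C^*_{L^p}(G)$ with dense image. Moreover, the identity map on $L^1(G)$ extends to a surjective $*$-homomorphism $C^*(\mathrm{PF}_p^*(G))\to C^*_{L^p}(G)$. -/

import Mathlib

open MeasureTheory
open scoped ENNReal NNReal
universe u

noncomputable section
namespace GroupAlg
open Measure Filter Topology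
open scoped Pointwise
set_option linter.unusedSectionVars false

section haar

variable {G : Type u} [Group G] [TopologicalSpace G] [IsTopologicalGroup G]
  [LocallyCompactSpace G] [MeasurableSpace G] [BorelSpace G]

/-! Modular function and inversion -/

lemma map_mul_right (μ : Measure G) [μ.IsHaarMeasure] [μ.Regular] (g : G) :
    μ.map (· * g) = (modularCharacterFun g) • μ := by
  have : (μ.map (· * g)).Regular := Regular.map (Homeomorph.mulRight g)
  rw [modularCharacterFun_eq_haarScalarFactor μ]
  exact isMulLeftInvariant_eq_smul_of_regular _ μ

lemma integral_mul_right' {E : Type*} [NormedAddCommGroup E] [NormedSpace ℝ E]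
    (μ : Measure G) [μ.IsHaarMeasure] [μ.Regular] (f : G → E) (g : G) :
    ∫ x, f (x * g) ∂μ = (modularCharacterFun g) • ∫ x, f x ∂μ := by
  have h := (Homeomorph.mulRight g).measurableEmbedding.integral_map (μ := μ) f
  simp only [Homeomorph.coe_mulRight] at h
  rw [← h, map_mul_right, integral_smul_nnreal_measure]

lemma integral_inv' {E : Type*} [NormedAddCommGroup E] [NormedSpace ℝ E]
    (μ : Measure G) (f : G → E) : ∫ x, f x ∂μ.inv = ∫ x, f x⁻¹ ∂μ :=
  (Homeomorph.inv G).measurableEmbedding.integral_map _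

lemma continuous_modular : Continuous (modularCharacterFun : G → ℝ≥0) := by
  have : Regular (haar : Measure G) := inferInstance
  obtain ⟨⟨f, f_cont⟩, f_comp, f_nonneg, f_one⟩ :
    ∃ f : C(G, ℝ), HasCompactSupport f ∧ 0 ≤ f ∧ f 1 ≠ 0 := exists_continuous_nonneg_pos 1
  have hpos : ∫ x, f x ∂(haar : Measure G) ≠ 0 :=
    ne_of_gt (f_cont.integral_pos_of_hasCompactSupport_nonneg_nonzero f_comp f_nonneg f_one)
  have h1 : Continuous fun x : G => ∫ y, f (y⁻¹ * x) ∂(haar : Measure G).inv :=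
    continuous_integral_apply_inv_mul f_cont f_comp
  have h2 : ∀ x : G, ∫ y, f (y⁻¹ * x) ∂(haar : Measure G).inv
      = (modularCharacterFun x : ℝ) * ∫ x, f x ∂(haar : Measure G) := by
    intro x
    rw [integral_inv']
    simpa [NNReal.smul_def] using integral_mul_right' (haar : Measure G) f x
  rw [NNReal.isEmbedding_coe.continuous_iff]
  simp_rw [h2] at h1
  have := h1.mul_const (∫ x, f x ∂(haar : Measure G))⁻¹
  refine this.congr fun x => ?_
  simp only [Function.comp]
  field_simp

/-- The measure `A ↦ ∫_{A⁻¹} Δ`. -/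
def invMod (μ : Measure G) : Measure G :=
  (μ.withDensity fun x => (modularCharacterFun x : ℝ≥0∞)).map (fun x => x⁻¹)

lemma measurable_modular : Measurable (modularCharacterFun : G → ℝ≥0) :=
  continuous_modular.measurable

lemma integral_invMod {E : Type*} [NormedAddCommGroup E] [NormedSpace ℝ E]
    (μ : Measure G) (f : G → E) :
    ∫ x, f x ∂(invMod μ) = ∫ x, modularCharacterFun x • f x⁻¹ ∂μ := by
  rw [invMod, ← integral_withDensity_eq_integral_smul measurable_modular]
  exact (Homeomorph.inv G).measurableEmbedding.integral_map _

lemma lintegral_invMod (μ : Measure G) (f : G → ℝ≥0∞) :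
    ∫⁻ x, f x ∂(invMod μ) = ∫⁻ x, modularCharacterFun x * f x⁻¹ ∂μ := by
  have h := (Homeomorph.inv G).measurableEmbedding.lintegral_map
    (μ := μ.withDensity fun x => (modularCharacterFun x : ℝ≥0∞)) f
  rw [invMod]
  refine h.trans ?_
  rw [lintegral_withDensity_eq_lintegral_mul_non_measurable₀]
  · rfl
  · exact measurable_modular.coe_nnreal_ennreal.aemeasurable
  · simp

lemma lintegral_mul_right' (μ : Measure G) [μ.IsHaarMeasure] [μ.Regular] (f : G → ℝ≥0∞) (g : G) :
    ∫⁻ x, f (x * g) ∂μ = (modularCharacterFun g) * ∫⁻ x, f x ∂μ := by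
  have h := (Homeomorph.mulRight g).measurableEmbedding.lintegral_map (μ := μ) f
  simp only [Homeomorph.coe_mulRight] at h
  rw [← h, map_mul_right]
  exact lintegral_smul_measure (modularCharacterFun g : ℝ≥0) f

lemma invMod_apply (μ : Measure G) {s : Set G} (hs : MeasurableSet s) :
    invMod μ s = ∫⁻ x, modularCharacterFun x * s.indicator 1 x⁻¹ ∂μ := by
  rw [← lintegral_invMod, lintegral_indicator_one hs]

instance (μ : Measure G) [μ.IsHaarMeasure] [μ.Regular] : (invMod μ).IsHaarMeasure where
  lt_top_of_isCompact := by
    intro K hK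
    have hc : IsCompact (closure K)⁻¹ := hK.closure.inv
    refine (measure_mono subset_closure).trans_lt ?_
    obtain ⟨C, hC⟩ := (hc.image (continuous_modular (G := G))).bddAbove
    rw [invMod_apply μ isClosed_closure.measurableSet]
    have : ∀ x : G, (modularCharacterFun x : ℝ≥0∞) * (closure K).indicator 1 x⁻¹
        ≤ ((closure K)⁻¹).indicator (fun _ => (C : ℝ≥0∞)) x := by
      intro x
      by_cases hx : x⁻¹ ∈ closure K
      · have hx' : x ∈ (closure K)⁻¹ := hx
        simp only [hx, hx', Set.indicator_of_mem, Pi.one_apply, mul_one]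
        exact_mod_cast hC ⟨x, hx', rfl⟩
      · simp [hx]
    refine (lintegral_mono this).trans_lt ?_
    rw [lintegral_indicator_const isClosed_closure.inv.measurableSet]
    exact ENNReal.mul_lt_top (by simp) hc.measure_lt_top
  map_mul_left_eq_self := by
    intro g
    ext s hs
    rw [map_apply (measurable_const_mul g) hs, invMod_apply μ hs,
      invMod_apply μ (measurable_const_mul g hs)]
    have h := lintegral_mul_right' μ
      (fun x => modularCharacterFun x * s.indicator (1 : G → ℝ≥0∞) x⁻¹) g⁻¹
    have hg : (modularCharacterFun g : ℝ≥0∞) ≠ 0 := by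
      exact_mod_cast (modularCharacterFun_pos g).ne'
    have hgg : modularCharacterFun g * modularCharacterFun g⁻¹ = 1 := by
      rw [← modularCharacterFun_map_mul, mul_inv_cancel, modularCharacterFun_map_one]
    have h2 := congrArg (fun t => (modularCharacterFun g : ℝ≥0∞) * t) h
    simp only [← mul_assoc] at h2
    rw [← ENNReal.coe_mul, hgg, ENNReal.coe_one, one_mul] at h2
    rw [← h2, ← lintegral_const_mul' _ _ ENNReal.coe_ne_top]
    refine lintegral_congr fun x => ?_
    simp only [modularCharacterFun_map_mul, mul_inv_rev, inv_inv, ENNReal.coe_mul]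
    have : (modularCharacterFun g : ℝ≥0∞) * (modularCharacterFun x * modularCharacterFun g⁻¹)
        = modularCharacterFun x := by
      rw [mul_left_comm, ← ENNReal.coe_mul, hgg, ENNReal.coe_one, mul_one]
    rw [← mul_assoc, this]
    rfl
  open_pos := by
    intro U hU hne h0
    rw [invMod_apply μ hU.measurableSet] at h0
    rw [lintegral_eq_zero_iff] at h0
    · have : μ U⁻¹ = 0 := by
        refine measure_mono_null ?_ h0
        intro x hx h
        have hx' : x⁻¹ ∈ U := hx
        simp [hx', (modularCharacterFun_pos x).ne'] at h
      exact hU.inv.measure_ne_zero μ (by simpa using hne) this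
    · exact measurable_modular.coe_nnreal_ennreal.mul
        ((measurable_one.indicator hU.measurableSet).comp measurable_inv)

/-- On compactly supported functions, `invMod μ` and `μ` integrate the same. -/
lemma integral_invMod_of_hasCompactSupport (μ : Measure G) [μ.IsHaarMeasure] [μ.Regular]
    {f : G → ℝ} (hf : Continuous f) (h'f : HasCompactSupport f) :
    ∫ x, f x ∂(invMod μ) = ∫ x, f x ∂μ := by
  obtain ⟨⟨g, g_cont⟩, g_comp, g_nonneg, g_one⟩ :
    ∃ f : C(G, ℝ), HasCompactSupport f ∧ 0 ≤ f ∧ f 1 ≠ 0 := exists_continuous_nonneg_pos 1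
  have hpos : ∫ x, g x ∂μ ≠ 0 :=
    ne_of_gt (g_cont.integral_pos_of_hasCompactSupport_nonneg_nonzero g_comp g_nonneg g_one)
  rw [integral_isMulLeftInvariant_isMulRightInvariant_combo (μ := μ) (ν := μ.inv) hf h'f g_cont
    g_comp g_nonneg g_one, integral_invMod, integral_inv', ← integral_mul_const]
  refine integral_congr_ae (Eventually.of_forall fun x => ?_)
  simp only [integral_inv', inv_inv]
  rw [integral_mul_right']
  have h1 : modularCharacterFun x * modularCharacterFun x⁻¹ = 1 := by
    rw [← modularCharacterFun_map_mul, mul_inv_cancel, modularCharacterFun_map_one]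
  have h2 : (modularCharacterFun x : ℝ) * modularCharacterFun x⁻¹ = 1 := by exact_mod_cast h1
  have h3 : (modularCharacterFun x⁻¹ : ℝ) ≠ 0 := by
    exact_mod_cast (modularCharacterFun_pos x⁻¹).ne'
  simp only [NNReal.smul_def, smul_eq_mul]
  field_simp
  linear_combination (f x⁻¹) * h2

lemma haarScalarFactor_invMod (μ : Measure G) [μ.IsHaarMeasure] [μ.Regular] :
    haarScalarFactor (invMod μ) μ = 1 := by
  obtain ⟨⟨g, g_cont⟩, g_comp, g_nonneg, g_one⟩ :
    ∃ f : C(G, ℝ), HasCompactSupport f ∧ 0 ≤ f ∧ f 1 ≠ 0 := exists_continuous_nonneg_pos 1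
  have hpos : ∫ x, g x ∂μ ≠ 0 :=
    ne_of_gt (g_cont.integral_pos_of_hasCompactSupport_nonneg_nonzero g_comp g_nonneg g_one)
  have := haarScalarFactor_eq_integral_div (invMod μ) μ g_cont g_comp hpos
  rw [integral_invMod_of_hasCompactSupport μ g_cont g_comp, div_self hpos] at this
  exact_mod_cast this

lemma invMod_le (μ : Measure G) [μ.IsHaarMeasure] [μ.Regular] : invMod μ ≤ μ := by
  refine Measure.le_iff'.2 fun s => ?_
  refine le_of_forall_gt fun r hr => ?_
  obtain ⟨U, hsU, hU, hUr⟩ := s.exists_isOpen_lt_of_lt r hr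
  refine (measure_mono hsU).trans_lt ?_
  rwa [measure_isHaarMeasure_eq_smul_of_isOpen (invMod μ) μ hU, haarScalarFactor_invMod, one_smul]

/-- Inversion preserves null sets. -/
lemma quasiMeasurePreserving_inv' (μ : Measure G) [μ.IsHaarMeasure] [μ.Regular] :
    QuasiMeasurePreserving (fun x : G => x⁻¹) μ μ := by
  refine ⟨measurable_inv, AbsolutelyContinuous.mk fun s hs h0 => ?_⟩
  rw [map_apply measurable_inv hs]
  have h1 : invMod μ s = 0 := le_antisymm ((invMod_le μ s).trans h0.le) zero_le
  rw [invMod_apply μ hs, lintegral_eq_zero_iff] at h1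
  · refine measure_mono_null ?_ h1
    intro x hx h
    have hx' : x⁻¹ ∈ s := hx
    simp [hx', (modularCharacterFun_pos x).ne'] at h
  · exact measurable_modular.coe_nnreal_ennreal.mul
        ((measurable_one.indicator hs).comp measurable_inv)

/-- Compactly supported continuous functions are dense in `L^p`, `p < ∞`. -/
lemma exists_hasCompactSupport_eLpNorm_sub_le (μ : Measure G) [μ.IsHaarMeasure] [μ.Regular]
    {p : ℝ≥0∞} (hp : p ≠ ∞) {f : G → ℂ} (hf : MemLp f p μ) {ε : ℝ≥0∞} (hε : ε ≠ 0) :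
    ∃ g : G → ℂ, eLpNorm (f - g) p μ ≤ ε ∧ (Continuous g ∧ HasCompactSupport g) := by
  apply hf.induction_dense hp _ _ _ _ hε
  · intro c t ht htμ ε hε
    obtain ⟨η, ηpos, hη⟩ :
      ∃ η : ℝ≥0, 0 < η ∧ ∀ s : Set G, μ s ≤ η → eLpNorm (s.indicator fun _x => c) p μ ≤ ε :=
      exists_eLpNorm_indicator_le hp c hε
    have ηpos' : (η / 2 : ℝ≥0∞) ≠ 0 := by simpa using ηpos.ne'
    obtain ⟨K, hKt, hK, hKc, hKμ⟩ := ht.exists_isCompact_isClosed_sdiff_lt htμ.ne ηpos'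
    obtain ⟨U, htU, hU, -, hUμ⟩ := ht.exists_isOpen_sdiff_lt htμ.ne ηpos'
    obtain ⟨φ, h1, h0, hc, h01⟩ := exists_continuous_one_zero_of_isCompact hK hU.isClosed_compl
      (Set.disjoint_compl_right_iff_subset.2 (hKt.trans htU))
    refine ⟨fun x => φ x • c, ?_, by fun_prop, ?_⟩
    · refine le_trans (eLpNorm_mono (g := (U \ K).indicator fun _ => c) fun x => ?_)
        (hη (U \ K) ?_)
      · by_cases hxK : x ∈ K
        · simp [hxK, hKt hxK, h1 hxK]
        · by_cases hxU : x ∈ U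
          · by_cases hxt : x ∈ t
            · have : φ x • c - c = (φ x - 1) • c := by rw [sub_smul, one_smul]
              simp only [hxt, hxU, hxK, Pi.sub_apply, Set.indicator_of_mem, Set.mem_sdiff,
                not_false_eq_true, and_self]
              rw [this, norm_smul]
              refine mul_le_of_le_one_left (norm_nonneg _) ?_
              rw [Real.norm_eq_abs, abs_le]
              constructor <;> linarith [(h01 x).1, (h01 x).2]
            · simp only [hxt, hxU, hxK, Pi.sub_apply, Set.indicator_of_mem, Set.mem_sdiff,
                not_false_eq_true, and_self, Set.indicator_of_notMem]
              rw [sub_zero, norm_smul]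
              refine mul_le_of_le_one_left (norm_nonneg _) ?_
              rw [Real.norm_eq_abs, abs_le]
              constructor <;> linarith [(h01 x).1, (h01 x).2]
          · have hxt : x ∉ t := fun h => hxU (htU h)
            have := h0 hxU
            simp [hxU, hxt, this]
      · have : U \ K ⊆ (U \ t) ∪ (t \ K) := by
          intro x hx
          by_cases h : x ∈ t
          · exact Or.inr ⟨h, hx.2⟩
          · exact Or.inl ⟨hx.1, h⟩
        calc μ (U \ K) ≤ μ (U \ t) + μ (t \ K) := (measure_mono this).trans (measure_union_le _ _)
          _ ≤ η / 2 + η / 2 := add_le_add hUμ.le hKμ.le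
          _ = η := ENNReal.add_halves _
    · exact hc.smul_right
  · rintro f g ⟨hf, hf'⟩ ⟨hg, hg'⟩
    exact ⟨hf.add hg, hf'.add hg'⟩
  · rintro f ⟨hf, hf'⟩
    exact hf.aestronglyMeasurable

end haar

section reps

variable {G : Type u} [Group G] [TopologicalSpace G] [IsTopologicalGroup G]
  [LocallyCompactSpace G] [MeasurableSpace G] [BorelSpace G]

lemma integrable_smul_of_continuous (μ : Measure G) [μ.IsHaarMeasure] [μ.Regular]
    {E : Type*} [NormedAddCommGroup E] [NormedSpace ℂ E] {f : G → ℂ} (hf : Integrable f μ)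
    {F : G → E} (hF : Continuous F) {C : ℝ} (hC : ∀ s, ‖F s‖ ≤ C) :
    Integrable (fun s => f s • F s) μ := by
  have hm : AEStronglyMeasurable (fun s => f s • F s) μ := by
    have h := fun n : ℕ => exists_hasCompactSupport_eLpNorm_sub_le μ ENNReal.one_ne_top
      (memLp_one_iff_integrable.2 hf) (ε := ENNReal.ofReal (1 / ((n : ℝ) + 1)))
      (by simp; positivity)
    choose g hg hgc hgs using h
    have ht : Tendsto (fun n => eLpNorm (g n - f) 1 μ) atTop (𝓝 0) := by
      refine tendsto_of_tendsto_of_tendsto_of_le_of_le tendsto_const_nhds ?_ (fun _ => zero_le)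
        (fun n => (eLpNorm_sub_comm _ _ _ _).trans_le (hg n))
      rw [← ENNReal.ofReal_zero]
      exact ENNReal.tendsto_ofReal tendsto_one_div_add_atTop_nhds_zero_nat
    obtain ⟨ns, -, hns⟩ := (tendstoInMeasure_of_tendsto_eLpNorm one_ne_zero
      (fun n => (hgc n).aestronglyMeasurable) hf.1 ht).exists_seq_tendsto_ae
    refine aestronglyMeasurable_of_tendsto_ae atTop (f := fun n s => g (ns n) s • F s)
      (fun n => ?_) ?_
    · exact (Continuous.integrable_of_hasCompactSupport ((hgc _).smul hF)
        ((hgs _).smul_right)).1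
    · filter_upwards [hns] with s hs
      exact hs.smul_const _
  refine (hf.norm.const_mul C).mono' hm (Eventually.of_forall fun s => ?_)
  rw [norm_smul, mul_comm]
  exact mul_le_mul_of_nonneg_right (hC s) (norm_nonneg _)

/-- A strongly continuous representation of `G` by contractions on a normed space. -/
structure BanachRep (G : Type*) [Group G] [TopologicalSpace G]
    (E : Type*) [NormedAddCommGroup E] [NormedSpace ℂ E] where
  toHom : G →* (E →L[ℂ] E)
  norm_le : ∀ s x, ‖toHom s x‖ ≤ ‖x‖
  cont : ∀ x, Continuous fun s => toHom s x

section integrated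
variable {E : Type*} [NormedAddCommGroup E] [NormedSpace ℂ E] [CompleteSpace E]

lemma BanachRep.integrable (U : BanachRep G E) (μ : Measure G) [μ.IsHaarMeasure] [μ.Regular]
    {f : G → ℂ} (hf : Integrable f μ) (x : E) : Integrable (fun s => f s • U.toHom s x) μ :=
  integrable_smul_of_continuous μ hf (U.cont x) (fun s => U.norm_le s x)

lemma norm_L1 {X : Type*} [MeasurableSpace X] (μ : Measure X) (f : Lp ℂ 1 μ) :
    ‖f‖ = ∫ s, ‖f s‖ ∂μ := L1.norm_eq_integral_norm f

/-- The integrated form `f ↦ ∫ f(s) U(s) ds` of a representation. -/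
def BanachRep.integrated (U : BanachRep G E) (μ : Measure G) [μ.IsHaarMeasure] [μ.Regular] :
    Lp ℂ 1 μ →L[ℂ] E →L[ℂ] E :=
  LinearMap.mkContinuous₂
    (LinearMap.mk₂ ℂ (fun (f : Lp ℂ 1 μ) (x : E) => ∫ s, f s • U.toHom s x ∂μ)
      (fun f g x => by
        rw [← integral_add (U.integrable μ (L1.integrable_coeFn f) x)
          (U.integrable μ (L1.integrable_coeFn g) x)]
        refine integral_congr_ae ?_
        filter_upwards [Lp.coeFn_add f g] with s hs
        rw [hs, Pi.add_apply, add_smul])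
      (fun c f x => by
        rw [← integral_smul]
        refine integral_congr_ae ?_
        filter_upwards [Lp.coeFn_smul c f] with s hs
        rw [hs, Pi.smul_apply, smul_assoc])
      (fun f x y => by
        rw [← integral_add (U.integrable μ (L1.integrable_coeFn f) x)
          (U.integrable μ (L1.integrable_coeFn f) y)]
        simp only [map_add, smul_add])
      (fun c f x => by
        rw [← integral_smul]
        simp only [map_smul, smul_comm c])) 1
    (fun f x => by
      rw [one_mul, norm_L1, ← integral_mul_const]
      refine norm_integral_le_of_norm_le ((L1.integrable_coeFn f).norm.mul_const _)
        (Eventually.of_forall fun s => ?_)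
      rw [norm_smul]
      exact mul_le_mul_of_nonneg_left (U.norm_le s x) (norm_nonneg _))

lemma BanachRep.integrated_apply (U : BanachRep G E) (μ : Measure G) [μ.IsHaarMeasure]
    [μ.Regular] (f : Lp ℂ 1 μ) (x : E) :
    U.integrated μ f x = ∫ s, f s • U.toHom s x ∂μ := rfl

lemma BanachRep.norm_integrated_le (U : BanachRep G E) (μ : Measure G) [μ.IsHaarMeasure]
    [μ.Regular] (f : Lp ℂ 1 μ) : ‖U.integrated μ f‖ ≤ ‖f‖ := by
  refine ContinuousLinearMap.opNorm_le_bound _ (norm_nonneg _) fun x => ?_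
  rw [U.integrated_apply, norm_L1, ← integral_mul_const]
  refine norm_integral_le_of_norm_le ((L1.integrable_coeFn f).norm.mul_const _)
    (Eventually.of_forall fun s => ?_)
  rw [norm_smul]
  exact mul_le_mul_of_nonneg_left (U.norm_le s x) (norm_nonneg _)

end integrated

/-- Left translation on `L^p`, `p < ∞`. -/
def leftReg (μ : Measure G) [μ.IsHaarMeasure] [μ.Regular] (p : ℝ≥0∞) [Fact (1 ≤ p)]
    (hp : p ≠ ∞) : BanachRep G (Lp ℂ p μ) where
  toHom :=
    { toFun := fun s => LinearMap.mkContinuous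
        { toFun := fun g => DomMulAct.mk s⁻¹ • g
          map_add' := fun g h => smul_add _ g h
          map_smul' := fun c g => smul_comm _ c g } 1 (fun g => by
            simp)
      map_one' := by ext1 g; simp
      map_mul' := fun s t => by
        ext1 g
        simp [mul_smul] }
  norm_le s g := by simp
  cont g := by
    have : Fact (p ≠ ∞) := ⟨hp⟩
    have h : Continuous fun s : G => DomMulAct.mk s⁻¹ :=
      DomMulAct.continuous_mk.comp continuous_inv
    exact h.smul continuous_const

lemma leftReg_apply (μ : Measure G) [μ.IsHaarMeasure] [μ.Regular] (p : ℝ≥0∞) [Fact (1 ≤ p)]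
    (hp : p ≠ ∞) (s : G) (g : Lp ℂ p μ) :
    (leftReg μ p hp).toHom s g =ᵐ[μ] fun t => g (s⁻¹ * t) :=
  DomMulAct.smul_Lp_ae_eq _ g

section
variable {E : Type*} [NormedAddCommGroup E] [NormedSpace ℂ E] [CompleteSpace E]
variable (μ : Measure G) [μ.IsHaarMeasure] [μ.Regular]

lemma BanachRep.integrated_leftReg (U : BanachRep G E) (r : G) (g : Lp ℂ 1 μ) (x : E) :
    U.integrated μ ((leftReg μ 1 ENNReal.one_ne_top).toHom r g) x
      = U.toHom r (U.integrated μ g x) := by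
  rw [U.integrated_apply, U.integrated_apply,
    ← ContinuousLinearMap.integral_comp_comm _ (U.integrable μ (L1.integrable_coeFn g) x)]
  rw [← integral_mul_left_eq_self (fun s => U.toHom r (g s • U.toHom s x)) r⁻¹]
  refine integral_congr_ae ?_
  filter_upwards [leftReg_apply μ 1 ENNReal.one_ne_top r g] with s hs
  rw [hs, map_smul, ← mul_apply_eq_comp, ← map_mul, mul_inv_cancel_left]

lemma BanachRep.integrated_integrated (U : BanachRep G E) (f g : Lp ℂ 1 μ) (x : E) :
    U.integrated μ ((leftReg μ 1 ENNReal.one_ne_top).integrated μ f g) x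
      = U.integrated μ f (U.integrated μ g x) := by
  rw [BanachRep.integrated_apply (leftReg μ 1 ENNReal.one_ne_top)]
  have := ContinuousLinearMap.integral_comp_comm ((U.integrated μ).flip x)
    ((leftReg μ 1 ENNReal.one_ne_top).integrable μ (L1.integrable_coeFn f) g)
  simp only [ContinuousLinearMap.flip_apply] at this
  refine this.symm.trans ?_
  rw [U.integrated_apply]
  refine integral_congr_ae (Eventually.of_forall fun s => ?_)
  simp only [map_smul, _root_.smul_apply]
  rw [BanachRep.integrated_leftReg]

end

end reps

section convolution

variable {G : Type u} [Group G] [TopologicalSpace G] [IsTopologicalGroup G]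
  [LocallyCompactSpace G] [MeasurableSpace G] [BorelSpace G]
variable (μ : Measure G)

/-- The convolution `(f * g)(t) = ∫ f(s) g(s⁻¹ t) ds` with respect to a left Haar measure. -/
def conv (f g : G → ℂ) (t : G) : ℂ := ∫ s, f s * g (s⁻¹ * t) ∂μ

variable [μ.IsHaarMeasure] [μ.Regular]

lemma qmp_inv_mul (t : G) : QuasiMeasurePreserving (fun s : G => s⁻¹ * t) μ μ := by
  have h := (quasiMeasurePreserving_inv' μ).comp
    (measurePreserving_mul_left μ t⁻¹).quasiMeasurePreserving
  have : (fun s : G => s⁻¹ * t) = (fun x : G => x⁻¹) ∘ fun x => t⁻¹ * x := by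
    ext s; simp
  rwa [this]

lemma conv_congr {f f' g g' : G → ℂ} (hf : f =ᵐ[μ] f') (hg : g =ᵐ[μ] g') :
    conv μ f g = conv μ f' g' := by
  ext t
  refine integral_congr_ae ?_
  filter_upwards [hf, (qmp_inv_mul μ t).ae hg] with s h1 h2
  rw [h1, h2]

lemma memLp_of_cc {p : ℝ≥0∞} {f : G → ℂ} (hf : Continuous f) (hf' : HasCompactSupport f) :
    MemLp f p μ := hf.memLp_of_hasCompactSupport hf'

/-- The bilinear pairing `∫ f g`. -/
def pair (p q : ℝ≥0∞) [Fact (1 ≤ p)] [Fact (1 ≤ q)] [ENNReal.HolderConjugate p q] :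
    Lp ℂ p μ →L[ℂ] Lp ℂ q μ →L[ℂ] ℂ :=
  (ContinuousLinearMap.mul ℂ ℂ).lpPairing μ p q

lemma pair_apply (p q : ℝ≥0∞) [Fact (1 ≤ p)] [Fact (1 ≤ q)] [ENNReal.HolderConjugate p q]
    (f : Lp ℂ p μ) (g : Lp ℂ q μ) : pair μ p q f g = ∫ x, f x * g x ∂μ := by
  simp [pair, ContinuousLinearMap.lpPairing_eq_integral]

lemma pair_indicator (p q : ℝ≥0∞) [Fact (1 ≤ p)] [Fact (1 ≤ q)] [ENNReal.HolderConjugate p q]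
    (f : Lp ℂ p μ) {A : Set G} (hA : MeasurableSet A) (hμA : μ A ≠ ∞) :
    pair μ p q f (indicatorConstLp q hA hμA 1) = ∫ x in A, f x ∂μ := by
  rw [pair_apply, ← integral_indicator hA]
  refine integral_congr_ae ?_
  filter_upwards [indicatorConstLp_coeFn (p := q) (hs := hA) (hμs := hμA) (c := (1 : ℂ))]
    with x hx
  rw [hx]
  by_cases h : x ∈ A <;> simp [h]

instance (p : ℝ≥0∞) [h : Fact (1 ≤ p)] : Fact (1 ≤ p.conjExponent) :=
  ⟨(ENNReal.HolderConjugate.conjExponent h.out).symm.one_le⟩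

section cc

lemma hasCompactSupport_kernel {f g : G → ℂ} (hf' : HasCompactSupport f)
    (hg' : HasCompactSupport g) :
    HasCompactSupport (Function.uncurry fun s t : G => f s * g (s⁻¹ * t)) := by
  let K := tsupport f
  let L := tsupport g
  refine HasCompactSupport.intro' (K := K ×ˢ (K * L)) ?_ ?_ ?_
  · exact hf'.isCompact.prod (hf'.isCompact.mul hg'.isCompact)
  · exact (isClosed_tsupport f).prod (IsClosed.mul_left_of_isCompact (isClosed_tsupport g) hf')
  · rintro ⟨s, t⟩ h
    simp only [Function.uncurry]
    by_contra h0
    have h1 : f s ≠ 0 := left_ne_zero_of_mul h0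
    have h2 : g (s⁻¹ * t) ≠ 0 := right_ne_zero_of_mul h0
    refine h ⟨subset_tsupport f h1, ?_⟩
    exact ⟨s, subset_tsupport f h1, s⁻¹ * t, subset_tsupport g h2, by simp⟩

lemma conv_cc {f g : G → ℂ} (hf : Continuous f) (hf' : HasCompactSupport f)
    (hg : Continuous g) (hg' : HasCompactSupport g) : Continuous (conv μ f g) ∧ HasCompactSupport (conv μ f g) := by
  constructor
  · rw [← continuousOn_univ]
    refine continuousOn_integral_of_compact_support (k := tsupport f) hf'.isCompact ?_ ?_
    · exact Continuous.continuousOn (by fun_prop)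
    · intro t s _ hs
      rw [image_eq_zero_of_notMem_tsupport hs, zero_mul]
  · refine HasCompactSupport.intro' (K := tsupport f * tsupport g)
      (hf'.isCompact.mul hg'.isCompact)
      (IsClosed.mul_left_of_isCompact (isClosed_tsupport g) hf') fun t ht => ?_
    refine integral_eq_zero_of_ae (Eventually.of_forall fun s => ?_)
    by_contra h0
    exact ht ⟨s, subset_tsupport f (left_ne_zero_of_mul h0), s⁻¹ * t,
      subset_tsupport g (right_ne_zero_of_mul h0), by simp⟩

lemma conv_eq_cc {f g : G → ℂ} (hf : Continuous f) (hf' : HasCompactSupport f)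
    (hg : Continuous g) (hg' : HasCompactSupport g)
    (p : ℝ≥0∞) [Fact (1 ≤ p)] (hp : p ≠ ∞) :
    conv μ f g =ᵐ[μ] (leftReg μ p hp).integrated μ ((memLp_of_cc μ hf hf').toLp f)
      ((memLp_of_cc μ hg hg').toLp g) := by
  obtain ⟨h1, h2⟩ := conv_cc μ hf hf' hg hg'
  have hc : MemLp (conv μ f g) p μ := memLp_of_cc μ h1 h2
  refine hc.coeFn_toLp.symm.trans ?_
  have hp1 : 1 ≤ p := Fact.out
  have hint : ∀ F : Lp ℂ p μ, ∀ s : Set G, MeasurableSet s → μ s < ∞ → IntegrableOn F s μ := by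
    intro F s _ hμs
    have : IsFiniteMeasure (μ.restrict s) := ⟨by simpa using hμs⟩
    exact ((Lp.memLp F).restrict s).integrable hp1
  refine Lp.ae_eq_of_forall_setIntegral_eq _ _ (by positivity) hp (hint _) (hint _) ?_
  intro A hA hμA
  have : ∫ t in A, (hc.toLp (conv μ f g)) t ∂μ = ∫ t in A, conv μ f g t ∂μ :=
    integral_congr_ae (ae_restrict_of_ae hc.coeFn_toLp)
  rw [this]
  simp only [conv]
  rw [← integral_integral_swap_of_hasCompactSupport
    (f := fun s t : G => f s * g (s⁻¹ * t)) (by fun_prop) (hasCompactSupport_kernel hf' hg')]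
  rw [← pair_indicator μ p p.conjExponent _ hA hμA.ne, BanachRep.integrated_apply]
  have h3 := ContinuousLinearMap.integral_comp_comm
    ((pair μ p p.conjExponent).flip (indicatorConstLp p.conjExponent hA hμA.ne 1))
    ((leftReg μ p hp).integrable μ
      (L1.integrable_coeFn ((memLp_of_cc (p := 1) μ hf hf').toLp f))
      ((memLp_of_cc μ hg hg').toLp g))
  refine Eq.trans ?_ h3
  refine integral_congr_ae ?_
  filter_upwards [(memLp_of_cc (p := 1) μ hf hf').coeFn_toLp] with s hs
  rw [hs]
  simp only [ContinuousLinearMap.flip_apply, map_smul]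
  rw [pair_indicator, integral_const_mul, smul_eq_mul]
  congr 1
  refine integral_congr_ae (ae_restrict_of_ae ?_)
  filter_upwards [leftReg_apply μ p hp s ((memLp_of_cc μ hg hg').toLp g),
    (measurePreserving_mul_left μ s⁻¹).quasiMeasurePreserving.ae
      (memLp_of_cc (p := p) μ hg hg').coeFn_toLp] with t h1 h2
  rw [h1, h2]

end cc

end convolution

section density

variable {G : Type u} [Group G] [TopologicalSpace G] [IsTopologicalGroup G]
  [LocallyCompactSpace G] [MeasurableSpace G] [BorelSpace G]
variable (μ : Measure G) [μ.IsHaarMeasure] [μ.Regular]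

/-- Classes of compactly supported continuous functions in `L^p`. -/
def ccSub (p : ℝ≥0∞) [Fact (1 ≤ p)] : AddSubgroup (Lp ℂ p μ) where
  carrier := {F | ∃ (f : G → ℂ) (hf : Continuous f) (hf' : HasCompactSupport f),
    F = (memLp_of_cc μ hf hf').toLp f}
  zero_mem' := ⟨0, continuous_zero, HasCompactSupport.zero, by
    rw [MemLp.toLp_zero]⟩
  add_mem' := by
    rintro _ _ ⟨f, hf, hf', rfl⟩ ⟨g, hg, hg', rfl⟩
    exact ⟨f + g, hf.add hg, hf'.add hg', by rw [MemLp.toLp_add]⟩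
  neg_mem' := by
    rintro _ ⟨f, hf, hf', rfl⟩
    exact ⟨-f, hf.neg, hf'.neg, by rw [MemLp.toLp_neg]⟩

lemma mem_closure_ccSub (p : ℝ≥0∞) [Fact (1 ≤ p)] (hp : p ≠ ∞) (F : Lp ℂ p μ) :
    F ∈ closure (ccSub μ p : Set (Lp ℂ p μ)) := by
  refine Metric.mem_closure_iff.2 fun ε hε => ?_
  obtain ⟨g, hg, hgc, hgs⟩ := exists_hasCompactSupport_eLpNorm_sub_le μ hp (Lp.memLp F)
    (ε := ENNReal.ofReal (ε / 2)) (by simpa using hε)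
  refine ⟨_, ⟨g, hgc, hgs, rfl⟩, ?_⟩
  rw [dist_eq_norm, Lp.norm_def]
  have : eLpNorm (F - (memLp_of_cc (p := p) μ hgc hgs).toLp g : Lp ℂ p μ) p μ
      = eLpNorm ((F : G → ℂ) - g) p μ := by
    refine eLpNorm_congr_ae ?_
    filter_upwards [Lp.coeFn_sub F ((memLp_of_cc (p := p) μ hgc hgs).toLp g),
      (memLp_of_cc (p := p) μ hgc hgs).coeFn_toLp] with x h1 h2
    rw [h1, Pi.sub_apply, h2, Pi.sub_apply]
  rw [this]
  refine (ENNReal.toReal_le_of_le_ofReal (by positivity) hg).trans_lt (by linarith)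

lemma norm_conv_le {f g : G → ℂ} (hf : Integrable f μ) {C : ℝ} (hg : ∀ t, ‖g t‖ ≤ C) (t : G) :
    ‖conv μ f g t‖ ≤ (∫ s, ‖f s‖ ∂μ) * C := by
  rw [← integral_mul_const]
  refine norm_integral_le_of_norm_le (hf.norm.mul_const _) (Eventually.of_forall fun s => ?_)
  rw [norm_mul]
  exact mul_le_mul_of_nonneg_left (hg _) (norm_nonneg _)

lemma integrable_kernel {f g : G → ℂ} (hf : Integrable f μ) (hg : Continuous g) {C : ℝ}
    (hC : ∀ t, ‖g t‖ ≤ C) (t : G) : Integrable (fun s => f s * g (s⁻¹ * t)) μ :=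
  integrable_smul_of_continuous μ hf (F := fun s => g (s⁻¹ * t)) (by fun_prop) (fun s => hC _)

lemma conv_eq_left (p : ℝ≥0∞) [Fact (1 ≤ p)] (hp : p ≠ ∞) (f : Lp ℂ 1 μ) {g : G → ℂ}
    (hg : Continuous g) (hg' : HasCompactSupport g) :
    conv μ f g =ᵐ[μ] (leftReg μ p hp).integrated μ f ((memLp_of_cc μ hg hg').toLp g) := by
  have hp1 : 1 ≤ p := Fact.out
  obtain ⟨C, hC⟩ := hg'.exists_bound_of_continuous hg
  obtain ⟨F, hF, hlim⟩ := mem_closure_iff_seq_limit.1 (mem_closure_ccSub μ 1 ENNReal.one_ne_top f)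
  set T := (leftReg μ p hp).integrated μ
  set g' := (memLp_of_cc (p := p) μ hg hg').toLp g
  have h1 : ∀ n, conv μ (F n) g =ᵐ[μ] T (F n) g' := by
    intro n
    obtain ⟨k, hk, hk', h⟩ := hF n
    rw [h, conv_congr μ (memLp_of_cc (p := 1) μ hk hk').coeFn_toLp (EventuallyEq.refl _ g)]
    exact conv_eq_cc μ hk hk' hg hg' p hp
  have h2 : Tendsto (fun n => T (F n) g') atTop (𝓝 (T f g')) :=
    ((T.flip g').continuous.tendsto f).comp hlim
  obtain ⟨ns, hns, h3⟩ := (tendstoInMeasure_of_tendsto_Lp h2).exists_seq_tendsto_ae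
  have h4 : ∀ t, Tendsto (fun n => conv μ (F n) g t) atTop (𝓝 (conv μ f g t)) := by
    intro t
    rw [tendsto_iff_norm_sub_tendsto_zero]
    have h0 : Tendsto (fun n => ‖F n - f‖ * C) atTop (𝓝 0) := by
      simpa using (tendsto_iff_norm_sub_tendsto_zero.1 hlim).mul_const C
    refine squeeze_zero (fun _ => norm_nonneg _) (fun n => ?_) h0
    have : conv μ (F n) g t - conv μ f g t = conv μ (F n - f : Lp ℂ 1 μ) g t := by
      rw [conv, conv, conv, ← integral_sub (integrable_kernel μ (L1.integrable_coeFn _) hg hC t)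
        (integrable_kernel μ (L1.integrable_coeFn _) hg hC t)]
      refine integral_congr_ae ?_
      filter_upwards [Lp.coeFn_sub (F n) f] with s hs
      rw [hs, Pi.sub_apply, sub_mul]
    rw [this, norm_L1]
    exact norm_conv_le μ (L1.integrable_coeFn _) hC t
  filter_upwards [h3, ae_all_iff.2 h1] with t ht ht'
  refine tendsto_nhds_unique ((h4 t).comp hns.tendsto_atTop) ?_
  simpa [Function.comp_def, ht'] using ht

lemma conv_eq (p : ℝ≥0∞) [Fact (1 ≤ p)] (hp : p ≠ ∞) (f : Lp ℂ 1 μ) (g : Lp ℂ p μ) :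
    conv μ f g =ᵐ[μ] (leftReg μ p hp).integrated μ f g := by
  set T := (leftReg μ p hp).integrated μ
  obtain ⟨v, hv, hvm, -, hvb⟩ := controlled_sum_of_mem_closure (mem_closure_ccSub μ p hp g)
    (b := fun n => (1 / 2 : ℝ) ^ n) (fun n => by positivity)
  have hsum : Summable fun n => ‖v n‖ := by
    refine Summable.of_norm_bounded_eventually_nat (g := fun n => (1 / 2 : ℝ) ^ n)
      summable_geometric_two ?_
    filter_upwards [eventually_gt_atTop 0] with n hn
    simpa using (hvb n hn).le
  have hg : HasSum v g := by
    have h := hsum.of_norm.hasSum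
    have h' := (tendsto_add_atTop_iff_nat 1).2 h.tendsto_sum_nat
    rwa [tendsto_nhds_unique h' hv] at h
  choose k hk hk' hvk using hvm
  -- absolute values
  have hfa : MemLp (fun s => (‖f s‖ : ℂ)) 1 μ := by
    rw [memLp_one_iff_integrable]
    exact (L1.integrable_coeFn f).norm.ofReal
  have hka : ∀ n, Continuous fun s => (‖k n s‖ : ℂ) := fun n => by
    have := hk n; fun_prop
  have hka' : ∀ n, HasCompactSupport fun s => (‖k n s‖ : ℂ) := fun n =>
    (hk' n).comp_left (g := fun z : ℂ => (‖z‖ : ℂ)) (by simp)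
  set w : ℕ → Lp ℂ p μ := fun n => T (hfa.toLp _) ((memLp_of_cc μ (hka n) (hka' n)).toLp _)
  have hw : Summable fun n => ‖w n‖ := by
    refine Summable.of_nonneg_of_le (fun _ => norm_nonneg _) (fun n => ?_)
      (hsum.mul_left ‖T (hfa.toLp _)‖)
    refine (ContinuousLinearMap.le_opNorm _ _).trans (mul_le_mul_of_nonneg_left ?_ (norm_nonneg _))
    rw [hvk n, Lp.norm_toLp, Lp.norm_toLp]
    refine le_of_eq (congrArg _ (eLpNorm_congr_norm_ae (Eventually.of_forall fun s => ?_)))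
    simp
  have ehw : ∑' n, ‖w n‖ₑ ≠ ∞ := by
    have := hw.tsum_ofReal_ne_top
    simpa [ofReal_norm] using this
  have ehv : ∑' n, ‖v n‖ₑ ≠ ∞ := by
    have := hsum.tsum_ofReal_ne_top
    simpa [ofReal_norm] using this
  have hTv : Summable fun n => ‖T f (v n)‖ :=
    Summable.of_nonneg_of_le (fun _ => norm_nonneg _)
      (fun n => ContinuousLinearMap.le_opNorm _ _) (hsum.mul_left ‖T f‖)
  have ehT : ∑' n, ‖T f (v n)‖ₑ ≠ ∞ := by
    have := hTv.tsum_ofReal_ne_top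
    simpa [ofReal_norm] using this
  have hTg : T f g = ∑' n, T f (v n) := ((T f).hasSum hg).tsum_eq.symm
  have a1 := Lp.hasSum_coeFn_tsum ehw
  have a2 : ∀ᵐ t ∂μ, ∀ n, conv μ (fun s => (‖f s‖ : ℂ)) (fun s => (‖k n s‖ : ℂ)) t = w n t := by
    refine ae_all_iff.2 fun n => ?_
    have := conv_eq_left μ p hp (hfa.toLp _) (hka n) (hka' n)
    rwa [conv_congr μ hfa.coeFn_toLp (EventuallyEq.refl _ _)] at this
  have a3 := Lp.hasSum_coeFn_tsum ehT
  have a4 : ∀ᵐ t ∂μ, ∀ n, conv μ f (k n) t = T f (v n) t := by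
    refine ae_all_iff.2 fun n => ?_
    rw [hvk n]
    exact conv_eq_left μ p hp f (hk n) (hk' n)
  have a5 : ∀ᵐ r ∂μ, HasSum (fun n => k n r) (g r) := by
    have h1 := Lp.hasSum_coeFn_tsum ehv
    rw [hg.tsum_eq] at h1
    have h2 : ∀ᵐ r ∂μ, ∀ n, v n r = k n r := by
      refine ae_all_iff.2 fun n => ?_
      rw [hvk n]
      exact MemLp.coeFn_toLp _
    filter_upwards [h1, h2] with r h1 h2
    simpa [h2] using h1
  filter_upwards [a1, a2, a3, a4] with t h1 h2 h3 h4
  rw [hTg]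
  refine HasSum.unique ?_ h3
  simp only [← h4]
  have hb : ∀ n, ∃ C, ∀ s, ‖k n s‖ ≤ C := fun n => (hk' n).exists_bound_of_continuous (hk n)
  choose C hC using hb
  have key := hasSum_integral_of_summable_integral_norm (μ := μ)
    (F := fun n s => f s * k n (s⁻¹ * t))
    (fun n => integrable_kernel μ (L1.integrable_coeFn f) (hk n) (hC n) t) ?_
  · have : ∫ s, ∑' n, f s * k n (s⁻¹ * t) ∂μ = conv μ f g t := by
      refine integral_congr_ae ?_
      filter_upwards [(qmp_inv_mul μ t).ae a5] with s hs
      exact (hs.mul_left (f s)).tsum_eq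
    rwa [this] at key
  · have h5 := h1.summable.norm
    simp only [← h2] at h5
    refine h5.congr fun n => ?_
    have : conv μ (fun s => (‖f s‖ : ℂ)) (fun s => (‖k n s‖ : ℂ)) t
        = ((∫ s, ‖f s * k n (s⁻¹ * t)‖ ∂μ : ℝ) : ℂ) := by
      rw [conv, ← integral_complex_ofReal]
      simp
    rw [this, Complex.norm_real, Real.norm_of_nonneg (integral_nonneg fun _ => norm_nonneg _)]

end density

section groupAlgebra

variable {G : Type u} [Group G] [TopologicalSpace G] [IsTopologicalGroup G]
  [LocallyCompactSpace G] [MeasurableSpace G] [BorelSpace G]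
variable (μ : Measure G) [μ.IsHaarMeasure] [μ.Regular]

section top

lemma ae_bound_top (g : Lp ℂ ∞ μ) (t : G) : ∀ᵐ s ∂μ, ‖g (s⁻¹ * t)‖ ≤ ‖g‖ := by
  have h : ∀ᵐ s ∂μ, ‖g s‖ ≤ ‖g‖ := by
    have := ae_le_eLpNormEssSup (f := g) (μ := μ)
    filter_upwards [this] with s hs
    rw [Lp.norm_def, eLpNorm_exponent_top]
    have h2 : eLpNormEssSup g μ ≠ ∞ := by
      rw [← eLpNorm_exponent_top]; exact Lp.eLpNorm_ne_top g
    simpa using ENNReal.toReal_mono h2 hs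
  exact (qmp_inv_mul μ t).ae h

lemma integrable_top {f : G → ℂ} (hf : Integrable f μ) (g : Lp ℂ ∞ μ) (t : G) :
    Integrable (fun s => f s * g (s⁻¹ * t)) μ := by
  refine hf.mul_bdd (c := ‖g‖) ?_ (ae_bound_top μ g t)
  exact (Lp.aestronglyMeasurable g).comp_quasiMeasurePreserving (qmp_inv_mul μ t)

lemma norm_conv_top_le {f : G → ℂ} (hf : Integrable f μ) (g : Lp ℂ ∞ μ) (t : G) :
    ‖conv μ f g t‖ ≤ (∫ s, ‖f s‖ ∂μ) * ‖g‖ := by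
  rw [← integral_mul_const]
  refine norm_integral_le_of_norm_le (hf.norm.mul_const _) ?_
  filter_upwards [ae_bound_top μ g t] with s hs
  rw [norm_mul]
  exact mul_le_mul_of_nonneg_left hs (norm_nonneg _)

lemma continuous_conv_top (f : Lp ℂ 1 μ) (g : Lp ℂ ∞ μ) : Continuous (conv μ f g) := by
  set U := leftReg μ 1 ENNReal.one_ne_top
  have key : ∀ t, conv μ f g t = conv μ (U.toHom t⁻¹ f) g 1 := by
    intro t
    rw [conv, conv, ← integral_mul_left_eq_self _ t]
    refine integral_congr_ae ?_
    filter_upwards [leftReg_apply μ 1 ENNReal.one_ne_top t⁻¹ f] with s hs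
    rw [hs]
    simp
  have hc : Continuous fun k : Lp ℂ 1 μ => conv μ k g 1 := by
    refine LipschitzWith.continuous (K := ‖g‖₊) (LipschitzWith.of_dist_le_mul fun k k' => ?_)
    rw [dist_eq_norm, dist_eq_norm, conv, conv,
      ← integral_sub (integrable_top μ (L1.integrable_coeFn _) g 1)
        (integrable_top μ (L1.integrable_coeFn _) g 1)]
    have : ∫ s, (k s * g (s⁻¹ * 1) - k' s * g (s⁻¹ * 1)) ∂μ = conv μ (k - k' : Lp ℂ 1 μ) g 1 := by
      refine integral_congr_ae ?_
      filter_upwards [Lp.coeFn_sub k k'] with s hs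
      rw [hs, Pi.sub_apply, sub_mul]
    rw [this, norm_L1, mul_comm]
    exact norm_conv_top_le μ (L1.integrable_coeFn _) g 1
  have : conv μ f g = fun t => conv μ (U.toHom t⁻¹ f) g 1 := funext key
  rw [this]
  exact hc.comp ((U.cont f).comp continuous_inv)

lemma memLp_conv_top (f : Lp ℂ 1 μ) (g : Lp ℂ ∞ μ) : MemLp (conv μ f g) ∞ μ :=
  memLp_top_of_bound (continuous_conv_top μ f g).aestronglyMeasurable (‖f‖ * ‖g‖)
    (Eventually.of_forall fun t => by
      rw [norm_L1]; exact norm_conv_top_le μ (L1.integrable_coeFn _) g t)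

end top

lemma memLp_conv (p : ℝ≥0∞) [Fact (1 ≤ p)] (f : Lp ℂ 1 μ) (g : Lp ℂ p μ) :
    MemLp (conv μ f g) p μ := by
  by_cases hp : p = ∞
  · subst hp
    exact memLp_conv_top μ f g
  · exact (memLp_congr_ae (conv_eq μ p hp f g)).2 (Lp.memLp _)

lemma toLp_conv (p : ℝ≥0∞) [Fact (1 ≤ p)] (hp : p ≠ ∞) (f : Lp ℂ 1 μ) (g : Lp ℂ p μ) :
    (memLp_conv μ p f g).toLp _ = (leftReg μ p hp).integrated μ f g := by
  ext1
  exact (MemLp.coeFn_toLp _).trans (conv_eq μ p hp f g)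

/-- The convolution operators `λ_p(f) g = f * g` on `L^p(G)`, for `f ∈ L¹(G)` and every
`1 ≤ p ≤ ∞`. -/
def lam (p : ℝ≥0∞) [Fact (1 ≤ p)] : Lp ℂ 1 μ →L[ℂ] Lp ℂ p μ →L[ℂ] Lp ℂ p μ :=
  LinearMap.mkContinuous₂
    (LinearMap.mk₂ ℂ (fun (f : Lp ℂ 1 μ) (g : Lp ℂ p μ) => (memLp_conv μ p f g).toLp (conv μ f g))
      (fun f f' g => by
        by_cases hp : p = ∞
        · subst hp
          rw [← MemLp.toLp_add]
          refine MemLp.toLp_congr _ _ (Eventually.of_forall fun t => ?_)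
          rw [Pi.add_apply, conv, conv, conv,
            ← integral_add (integrable_top μ (L1.integrable_coeFn f) g t)
              (integrable_top μ (L1.integrable_coeFn f') g t)]
          refine integral_congr_ae ?_
          filter_upwards [Lp.coeFn_add f f'] with s hs
          rw [hs, Pi.add_apply, add_mul]
        · simp only [toLp_conv μ p hp, map_add, _root_.add_apply])
      (fun c f g => by
        by_cases hp : p = ∞
        · subst hp
          rw [← MemLp.toLp_const_smul]
          refine MemLp.toLp_congr _ _ (Eventually.of_forall fun t => ?_)
          rw [Pi.smul_apply, conv, conv, ← integral_smul]
          refine integral_congr_ae ?_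
          filter_upwards [Lp.coeFn_smul c f] with s hs
          rw [hs, Pi.smul_apply, smul_mul_assoc]
        · simp only [toLp_conv μ p hp, map_smul, _root_.smul_apply])
      (fun f g g' => by
        by_cases hp : p = ∞
        · subst hp
          rw [← MemLp.toLp_add]
          refine MemLp.toLp_congr _ _ (Eventually.of_forall fun t => ?_)
          rw [Pi.add_apply, conv, conv, conv,
            ← integral_add (integrable_top μ (L1.integrable_coeFn f) g t)
              (integrable_top μ (L1.integrable_coeFn f) g' t)]
          refine integral_congr_ae ?_
          filter_upwards [(qmp_inv_mul μ t).ae (Lp.coeFn_add g g')] with s hs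
          rw [hs, Pi.add_apply, mul_add]
        · simp only [toLp_conv μ p hp, map_add])
      (fun c f g => by
        by_cases hp : p = ∞
        · subst hp
          rw [← MemLp.toLp_const_smul]
          refine MemLp.toLp_congr _ _ (Eventually.of_forall fun t => ?_)
          rw [Pi.smul_apply, conv, conv, ← integral_smul]
          refine integral_congr_ae ?_
          filter_upwards [(qmp_inv_mul μ t).ae (Lp.coeFn_smul c g)] with s hs
          rw [hs, Pi.smul_apply, mul_smul_comm]
        · simp only [toLp_conv μ p hp, map_smul])) 1
    (fun f g => by
      rw [one_mul]
      change ‖(memLp_conv μ p f g).toLp (conv μ f g)‖ ≤ _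
      by_cases hp : p = ∞
      · subst hp
        rw [Lp.norm_toLp, eLpNorm_exponent_top]
        refine ENNReal.toReal_le_of_le_ofReal (by positivity)
          (eLpNormEssSup_le_of_ae_bound (Eventually.of_forall fun t => ?_))
        rw [norm_L1]
        exact norm_conv_top_le μ (L1.integrable_coeFn f) g t
      · rw [toLp_conv μ p hp]
        exact (ContinuousLinearMap.le_opNorm _ _).trans
          (mul_le_mul_of_nonneg_right (BanachRep.norm_integrated_le _ μ f) (norm_nonneg _)))

lemma lam_apply (p : ℝ≥0∞) [Fact (1 ≤ p)] (f : Lp ℂ 1 μ) (g : Lp ℂ p μ) :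
    lam μ p f g = (memLp_conv μ p f g).toLp (conv μ f g) := rfl

lemma lam_eq (p : ℝ≥0∞) [Fact (1 ≤ p)] (hp : p ≠ ∞) (f : Lp ℂ 1 μ) :
    lam μ p f = (leftReg μ p hp).integrated μ f := by
  ext1 g
  exact toLp_conv μ p hp f g

lemma norm_lam_apply_le (p : ℝ≥0∞) [Fact (1 ≤ p)] (f : Lp ℂ 1 μ) (g : Lp ℂ p μ) :
    ‖lam μ p f g‖ ≤ ‖f‖ * ‖g‖ := by
  refine (ContinuousLinearMap.le_opNorm₂ _ f g).trans ?_
  refine mul_le_mul_of_nonneg_right ?_ (norm_nonneg _)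
  refine mul_le_of_le_one_left (norm_nonneg _) ?_
  exact LinearMap.mkContinuous₂_norm_le _ zero_le_one _

lemma norm_lam_le (p : ℝ≥0∞) [Fact (1 ≤ p)] (f : Lp ℂ 1 μ) : ‖lam μ p f‖ ≤ ‖f‖ :=
  ContinuousLinearMap.opNorm_le_bound _ (norm_nonneg _) (norm_lam_apply_le μ p f)

/-! The involution. -/

lemma modular_mul_inv (x : G) : modularCharacterFun x * modularCharacterFun x⁻¹ = 1 := by
  rw [← modularCharacterFun_map_mul, mul_inv_cancel, modularCharacterFun_map_one]

lemma invMod_eq : invMod μ = μ := by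
  refine le_antisymm (invMod_le μ) (Measure.le_iff.2 fun s hs => ?_)
  have h1 : μ s = ∫⁻ x, modularCharacterFun x * s.indicator 1 x⁻¹ ∂(invMod μ) := by
    rw [lintegral_invMod, ← lintegral_indicator_one hs]
    refine lintegral_congr fun x => ?_
    rw [inv_inv, ← mul_assoc, ← ENNReal.coe_mul, modular_mul_inv, ENNReal.coe_one, one_mul]
  rw [h1, invMod_apply μ hs]
  exact lintegral_mono' (invMod_le μ) le_rfl

/-- Change of variables `s ↦ s⁻¹`. -/
lemma integral_modular_inv {E : Type*} [NormedAddCommGroup E] [NormedSpace ℝ E] (F : G → E) :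
    ∫ s, modularCharacterFun s • F s⁻¹ ∂μ = ∫ s, F s ∂μ := by
  rw [← integral_invMod, invMod_eq]

/-- The involution `f^*(s) = Δ(s) conj (f (s⁻¹))`, where `Δ` is the `modularCharacterFun` of
Mathlib, which satisfies `μ (A s⁻¹) = Δ(s) μ(A)`. It is the inverse of the modular function
normalized by `μ (A s) = Δ(s) μ(A)`, so this is the usual involution of `L¹(G)`. -/
def starFn (f : G → ℂ) (s : G) : ℂ :=
  modularCharacterFun s • (starRingEnd ℂ) (f s⁻¹)

lemma norm_starFn (f : G → ℂ) (s : G) : ‖starFn f s‖ = modularCharacterFun s • ‖f s⁻¹‖ := by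
  simp [starFn, NNReal.smul_def]

lemma starFn_starFn (f : G → ℂ) : starFn (starFn f) = f := by
  ext s
  have h : (modularCharacterFun s : ℂ) * modularCharacterFun s⁻¹ = 1 := by
    exact_mod_cast congrArg (fun x : ℝ≥0 => (x : ℂ)) (modular_mul_inv s)
  simp only [starFn, inv_inv, NNReal.smul_def, Complex.real_smul, map_mul, Complex.conj_ofReal,
    Complex.conj_conj, ← mul_assoc]
  rw [h, one_mul]

lemma starFn_congr {f g : G → ℂ} (h : f =ᵐ[μ] g) : starFn f =ᵐ[μ] starFn g := by
  filter_upwards [(quasiMeasurePreserving_inv' μ).ae h] with s hs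
  rw [starFn, starFn, hs]

lemma integrable_starFn {f : G → ℂ} (hf : Integrable f μ) : Integrable (starFn f) μ := by
  have hm : AEStronglyMeasurable (starFn f) μ := by
    have h := hf.1.comp_quasiMeasurePreserving (quasiMeasurePreserving_inv' μ)
    have h2 := Complex.continuous_conj.comp_aestronglyMeasurable h
    exact measurable_modular.aestronglyMeasurable.smul h2
  refine ⟨hm, ?_⟩
  have := lintegral_invMod μ (fun s => ‖f s‖ₑ)
  rw [invMod_eq] at this
  rw [HasFiniteIntegral]
  refine lt_of_eq_of_lt ?_ hf.2
  rw [this]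
  refine lintegral_congr fun s => ?_
  rw [starFn, NNReal.smul_def, enorm_smul]
  simp [Real.enorm_eq_ofReal]

lemma integral_norm_starFn (f : G → ℂ) : ∫ s, ‖starFn f s‖ ∂μ = ∫ s, ‖f s‖ ∂μ := by
  simp_rw [norm_starFn]
  exact integral_modular_inv μ fun s => ‖f s‖

/-- Involution against a test function. -/
lemma integral_starFn_mul (f : G → ℂ) (B : G → ℂ) :
    ∫ s, starFn f s * B s ∂μ = ∫ s, (starRingEnd ℂ) (f s) * B s⁻¹ ∂μ := by
  rw [← integral_modular_inv μ]
  refine integral_congr_ae (Eventually.of_forall fun s => ?_)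
  have h := modular_mul_inv s
  simp only [starFn, inv_inv, smul_mul_assoc, smul_smul, h, one_smul]

lemma starFn_conv (f g : G → ℂ) : starFn (conv μ f g) = conv μ (starFn g) (starFn f) := by
  ext t
  rw [starFn, conv, conv, ← integral_conj, NNReal.smul_def, ← integral_smul,
    ← integral_mul_left_eq_self _ t⁻¹]
  refine integral_congr_ae (Eventually.of_forall fun s => ?_)
  have h : modularCharacterFun t = modularCharacterFun s * modularCharacterFun (s⁻¹ * t) := by
    rw [← modularCharacterFun_map_mul, mul_inv_cancel_left]
  simp only [starFn, NNReal.smul_def, Complex.real_smul, map_mul, mul_inv_rev, inv_inv, h,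
    NNReal.coe_mul, Complex.ofReal_mul, mul_inv_cancel_right]
  ring

/-! The group algebra `L¹(G)`. -/

/-- The Banach `*`-algebra `L¹(G)`, with the convolution product and the involution `starFn`. -/
def GroupL1 {G : Type u} [MeasurableSpace G] (μ : Measure G) : Type u := Lp ℂ 1 μ

namespace GroupL1

instance : NormedAddCommGroup (GroupL1 μ) := inferInstanceAs (NormedAddCommGroup (Lp ℂ 1 μ))
instance : NormedSpace ℂ (GroupL1 μ) := inferInstanceAs (NormedSpace ℂ (Lp ℂ 1 μ))
instance : CompleteSpace (GroupL1 μ) := inferInstanceAs (CompleteSpace (Lp ℂ 1 μ))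

/-- The underlying class of functions. -/
def toLp (f : GroupL1 μ) : Lp ℂ 1 μ := f

instance : Mul (GroupL1 μ) := ⟨fun f g =>
  (memLp_conv μ 1 (toLp μ f) (toLp μ g)).toLp (conv μ (toLp μ f) (toLp μ g))⟩

instance : Star (GroupL1 μ) := ⟨fun f =>
  (memLp_one_iff_integrable.2 (integrable_starFn μ (L1.integrable_coeFn (toLp μ f)))).toLp
    (starFn (toLp μ f))⟩

lemma mul_def (f g : GroupL1 μ) : f * g = lam μ 1 (toLp μ f) (toLp μ g) := rfl

lemma coeFn_mul (f g : GroupL1 μ) :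
    (toLp μ (f * g) : G → ℂ) =ᵐ[μ] conv μ (toLp μ f) (toLp μ g) :=
  (memLp_conv μ 1 (toLp μ f) (toLp μ g)).coeFn_toLp

lemma coeFn_star (f : GroupL1 μ) :
    (toLp μ (star f) : G → ℂ) =ᵐ[μ] starFn (toLp μ f) :=
  (memLp_one_iff_integrable.2 (integrable_starFn μ (L1.integrable_coeFn (toLp μ f)))).coeFn_toLp

lemma lam_mul {p : ℝ≥0∞} [Fact (1 ≤ p)] (hp : p ≠ ∞) (f g : GroupL1 μ) :
    lam μ p (toLp μ (f * g)) = lam μ p (toLp μ f) * lam μ p (toLp μ g) := by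
  ext1 h
  rw [lam_eq μ p hp, lam_eq μ p hp, lam_eq μ p hp, mul_apply_eq_comp,
    ← BanachRep.integrated_integrated, ← lam_eq μ 1 ENNReal.one_ne_top]
  rfl

instance : NonUnitalNormedRing (GroupL1 μ) where
  left_distrib f g h := (lam μ 1 (toLp μ f)).map_add (toLp μ g) (toLp μ h)
  right_distrib f g h := (lam μ 1).map_add₂ (toLp μ f) (toLp μ g) (toLp μ h)
  zero_mul f := (lam μ 1).map_zero₂ (toLp μ f)
  mul_zero f := (lam μ 1 (toLp μ f)).map_zero
  mul_assoc f g h := by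
    have := DFunLike.congr_fun (lam_mul μ ENNReal.one_ne_top f g) (toLp μ h)
    exact this
  dist_eq f g := dist_eq_norm_neg_add f g
  norm_mul_le f g := norm_lam_apply_le μ 1 (toLp μ f) (toLp μ g)

instance : IsScalarTower ℂ (GroupL1 μ) (GroupL1 μ) :=
  ⟨fun c f g => (lam μ 1).map_smul₂ c (toLp μ f) (toLp μ g)⟩

instance : SMulCommClass ℂ (GroupL1 μ) (GroupL1 μ) :=
  ⟨fun c f g => ((lam μ 1 (toLp μ f)).map_smul c (toLp μ g)).symm⟩

lemma ext' {f g : GroupL1 μ} (h : (toLp μ f : G → ℂ) =ᵐ[μ] toLp μ g) : f = g :=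
  Lp.ext h

instance : StarRing (GroupL1 μ) where
  star_involutive f := by
    refine ext' μ ?_
    refine (coeFn_star μ _).trans ((starFn_congr μ (coeFn_star μ f)).trans ?_)
    rw [starFn_starFn]
  star_mul f g := by
    refine ext' μ ?_
    refine (coeFn_star μ _).trans ((starFn_congr μ (coeFn_mul μ f g)).trans ?_)
    refine EventuallyEq.trans ?_ (coeFn_mul μ _ _).symm
    rw [starFn_conv, conv_congr μ (coeFn_star μ g) (coeFn_star μ f)]
  star_add f g := by
    refine ext' μ ?_
    refine (coeFn_star μ _).trans ((starFn_congr μ (Lp.coeFn_add (toLp μ f) (toLp μ g))).trans ?_)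
    refine EventuallyEq.trans ?_ (Lp.coeFn_add (toLp μ (star f)) (toLp μ (star g))).symm
    filter_upwards [coeFn_star μ f, coeFn_star μ g] with s h1 h2
    rw [Pi.add_apply, h1, h2]
    simp [starFn]

instance : StarModule ℂ (GroupL1 μ) where
  star_smul c f := by
    refine ext' μ ?_
    refine (coeFn_star μ _).trans ((starFn_congr μ (Lp.coeFn_smul c (toLp μ f))).trans ?_)
    refine EventuallyEq.trans ?_ (Lp.coeFn_smul (star c) (toLp μ (star f))).symm
    filter_upwards [coeFn_star μ f] with s h1
    rw [Pi.smul_apply, h1]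
    simp [starFn]

instance : NormedStarGroup (GroupL1 μ) where
  norm_star_le f := by
    change ‖toLp μ (star f)‖ ≤ ‖toLp μ f‖
    rw [norm_L1, norm_L1, ← integral_norm_starFn μ (toLp μ f)]
    refine le_of_eq (integral_congr_ae ?_)
    filter_upwards [coeFn_star μ f] with s h1
    rw [h1]

end GroupL1

end groupAlgebra

section completions

/-- A submultiplicative, star-invariant seminorm on a complex `*`-algebra. -/
structure StarSeminorm (A : Type*) [NonUnitalRing A] [Module ℂ A] [StarRing A]
    extends Seminorm ℂ A where
  mul_le' : ∀ a b, toFun (a * b) ≤ toFun a * toFun b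
  star_le' : ∀ a, toFun (star a) ≤ toFun a

namespace StarSeminorm

section
variable {A : Type*} [NonUnitalRing A] [Module ℂ A] [StarRing A]

instance : CoeFun (StarSeminorm A) fun _ => A → ℝ := ⟨fun N => N.toSeminorm⟩

lemma mul_le (N : StarSeminorm A) (a b : A) : N (a * b) ≤ N a * N b := N.mul_le' a b

lemma star_eq (N : StarSeminorm A) (a : A) : N (star a) = N a :=
  le_antisymm (N.star_le' a) (by
    have h := N.star_le' (star a)
    rwa [star_star] at h)

/-- The `C^*`-condition. -/
def IsCStar (N : StarSeminorm A) : Prop := ∀ a, N a * N a ≤ N (star a * a)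

/-- The pointwise supremum of a bounded family. -/
def sup {ι : Sort*} (N : ι → StarSeminorm A) (h : ∀ a, BddAbove (Set.range fun i => N i a)) :
    StarSeminorm A where
  toFun a := ⨆ i, N i a
  map_zero' := by simp
  add_le' a b := Real.iSup_le (fun i => (map_add_le_add (N i).toSeminorm a b).trans
    (add_le_add (le_ciSup (h a) i) (le_ciSup (h b) i)))
    (add_nonneg (Real.iSup_nonneg fun i => apply_nonneg _ _)
      (Real.iSup_nonneg fun i => apply_nonneg _ _))
  neg' a := by simp
  smul' c a := by simp only [map_smul_eq_mul, Real.mul_iSup_of_nonneg (norm_nonneg c)]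
  mul_le' a b := Real.iSup_le (fun i => ((N i).mul_le a b).trans
    (mul_le_mul (le_ciSup (h a) i) (le_ciSup (h b) i) (apply_nonneg _ _)
      (Real.iSup_nonneg fun i => apply_nonneg _ _)))
    (mul_nonneg (Real.iSup_nonneg fun i => apply_nonneg _ _)
      (Real.iSup_nonneg fun i => apply_nonneg _ _))
  star_le' a := by simp only [star_eq, le_refl]

lemma sup_apply {ι : Sort*} (N : ι → StarSeminorm A)
    (h : ∀ a, BddAbove (Set.range fun i => N i a)) (a : A) : sup N h a = ⨆ i, N i a := rfl

lemma isCStar_sup {ι : Sort*} (N : ι → StarSeminorm A)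
    (h : ∀ a, BddAbove (Set.range fun i => N i a)) (hN : ∀ i, (N i).IsCStar) :
    (sup N h).IsCStar := by
  intro a
  have h0 : 0 ≤ sup N h (star a * a) := apply_nonneg _ _
  have h1 : sup N h a ≤ √(sup N h (star a * a)) :=
    Real.iSup_le (fun i => Real.le_sqrt_of_sq_le (by
      rw [sq]
      exact (hN i a).trans (le_ciSup (h (star a * a)) i))) (Real.sqrt_nonneg _)
  calc sup N h a * sup N h a ≤ √(sup N h (star a * a)) * √(sup N h (star a * a)) :=
        mul_self_le_mul_self (apply_nonneg _ _) h1
    _ = _ := Real.mul_self_sqrt h0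

end

section space
variable {A : Type u} [NonUnitalRing A] [Module ℂ A] [StarRing A]

/-- `A`, equipped with the seminorm `N`. -/
def Space (_N : StarSeminorm A) : Type u := A

variable (N : StarSeminorm A)

instance : NonUnitalRing N.Space := inferInstanceAs (NonUnitalRing A)
instance : Module ℂ N.Space := inferInstanceAs (Module ℂ A)
instance : StarRing N.Space := inferInstanceAs (StarRing A)
instance [IsScalarTower ℂ A A] : IsScalarTower ℂ N.Space N.Space :=
  inferInstanceAs (IsScalarTower ℂ A A)
instance [SMulCommClass ℂ A A] : SMulCommClass ℂ N.Space N.Space :=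
  inferInstanceAs (SMulCommClass ℂ A A)
instance [StarModule ℂ A] : StarModule ℂ N.Space := inferInstanceAs (StarModule ℂ A)

instance : NonUnitalSeminormedRing N.Space where
  __ := (inferInstance : NonUnitalRing N.Space)
  __ := N.toSeminorm.toAddGroupSeminorm.toSeminormedAddCommGroup
  norm_mul_le a b := N.mul_le a b

lemma norm_space (a : N.Space) : ‖a‖ = N (a : A) := rfl

instance : NormedSpace ℂ N.Space where
  norm_smul_le c a := (map_smul_eq_mul N.toSeminorm c a).le

instance : NormedStarGroup N.Space where
  norm_star_le a := N.star_le' a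

/-- The (Hausdorff) completion of `A` with respect to `N`, a Banach `*`-algebra. -/
def Completion : Type u := UniformSpace.Completion N.Space

open UniformSpace

instance : NormedAddCommGroup N.Completion :=
  inferInstanceAs (NormedAddCommGroup (UniformSpace.Completion N.Space))
instance : NormedSpace ℂ N.Completion :=
  inferInstanceAs (NormedSpace ℂ (UniformSpace.Completion N.Space))
instance : CompleteSpace N.Completion :=
  inferInstanceAs (CompleteSpace (UniformSpace.Completion N.Space))

/-- The canonical map of `A` into its completion; its range is dense and `‖N.of a‖ = N a`. -/
def of (a : A) : N.Completion := ((show N.Space from a : N.Space) : UniformSpace.Completion N.Space)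

lemma norm_of (a : A) : ‖N.of a‖ = N a := UniformSpace.Completion.norm_coe (E := N.Space) a

lemma of_add (a b : A) : N.of (a + b) = N.of a + N.of b :=
  UniformSpace.Completion.coe_add (α := N.Space) a b

lemma of_smul (c : ℂ) (a : A) : N.of (c • a) = c • N.of a :=
  UniformSpace.Completion.coe_smul (X := N.Space) c a

lemma of_zero : N.of 0 = 0 := rfl

lemma denseRange_of : DenseRange N.of := UniformSpace.Completion.denseRange_coe (α := N.Space)

/-- `of` as a dense embedding of seminormed spaces. -/
def ofS (a : N.Space) : N.Completion := N.of a

lemma continuous_ofS : Continuous N.ofS := UniformSpace.Completion.continuous_coe N.Space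

lemma isDenseInducing_ofS : IsDenseInducing N.ofS :=
  UniformSpace.Completion.isDenseInducing_coe (α := N.Space)

variable {N} in
@[elab_as_elim]
lemma induction_on {p : N.Completion → Prop} (x : N.Completion) (hp : IsClosed {x | p x})
    (h : ∀ a : A, p (N.of a)) : p x :=
  UniformSpace.Completion.induction_on (α := N.Space) x hp h

variable {N} in
@[elab_as_elim]
lemma induction_on₂ {p : N.Completion → N.Completion → Prop} (x y : N.Completion)
    (hp : IsClosed {x : N.Completion × N.Completion | p x.1 x.2})
    (h : ∀ a b : A, p (N.of a) (N.of b)) : p x y :=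
  UniformSpace.Completion.induction_on₂ (α := N.Space) (β := N.Space) x y hp h

variable {N} in
@[elab_as_elim]
lemma induction_on₃ {p : N.Completion → N.Completion → N.Completion → Prop}
    (x y z : N.Completion)
    (hp : IsClosed {x : N.Completion × N.Completion × N.Completion | p x.1 x.2.1 x.2.2})
    (h : ∀ a b c : A, p (N.of a) (N.of b) (N.of c)) : p x y z :=
  UniformSpace.Completion.induction_on₃ (α := N.Space) (β := N.Space) (γ := N.Space) x y z hp h

instance : Mul N.Completion :=
  ⟨Function.curry <| (N.isDenseInducing_ofS.prodMap N.isDenseInducing_ofS).extend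
    (N.ofS ∘ Function.uncurry (· * ·))⟩

lemma of_mul (a b : A) : N.of (a * b) = N.of a * N.of b :=
  ((N.isDenseInducing_ofS.prodMap N.isDenseInducing_ofS).extend_eq
    (N.continuous_ofS.comp (continuous_mul (M := N.Space))) (a, b)).symm

instance : ContinuousMul N.Completion where
  continuous_mul := by
    let m : N.Space →+ N.Space →+ N.Completion :=
      (AddMonoidHom.mul : N.Space →+ N.Space →+ N.Space).compr₂
        (UniformSpace.Completion.toCompl : N.Space →+ UniformSpace.Completion N.Space)
    have : Continuous fun p : N.Space × N.Space => m p.1 p.2 :=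
      N.continuous_ofS.comp (continuous_mul (M := N.Space))
    have di : IsDenseInducing
      (UniformSpace.Completion.toCompl : N.Space → UniformSpace.Completion N.Space) :=
      N.isDenseInducing_ofS
    exact (di.extend_Z_bilin di this :)

instance : NonUnitalNormedRing N.Completion where
  __ := (inferInstance : NormedAddCommGroup N.Completion)
  zero_mul a := induction_on a (isClosed_eq (by fun_prop) continuous_const)
    fun a => by rw [← of_zero, ← of_mul, zero_mul]
  mul_zero a := induction_on a (isClosed_eq (by fun_prop) continuous_const)
    fun a => by rw [← of_zero, ← of_mul, mul_zero]
  mul_assoc a b c := induction_on₃ a b c (isClosed_eq (by fun_prop) (by fun_prop))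
    fun a b c => by rw [← of_mul, ← of_mul, ← of_mul, ← of_mul, mul_assoc]
  left_distrib a b c := induction_on₃ a b c (isClosed_eq (by fun_prop) (by fun_prop))
    fun a b c => by rw [← of_add, ← of_mul, ← of_mul, ← of_mul, ← of_add, mul_add]
  right_distrib a b c := induction_on₃ a b c (isClosed_eq (by fun_prop) (by fun_prop))
    fun a b c => by rw [← of_add, ← of_mul, ← of_mul, ← of_mul, ← of_add, add_mul]
  norm_mul_le a b := induction_on₂ a b (isClosed_le (by fun_prop) (by fun_prop))
    fun a b => by rw [← of_mul, norm_of, norm_of, norm_of]; exact N.mul_le a b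

instance [IsScalarTower ℂ A A] : IsScalarTower ℂ N.Completion N.Completion :=
  ⟨fun c a b => induction_on₂ a b
    (isClosed_eq (((continuous_const_smul c).comp continuous_fst).mul continuous_snd)
      ((continuous_const_smul c).comp continuous_mul))
    fun a b => by
      rw [smul_eq_mul, smul_eq_mul, ← of_smul, ← of_mul, ← of_mul, ← of_smul, smul_mul_assoc]⟩

instance [SMulCommClass ℂ A A] : SMulCommClass ℂ N.Completion N.Completion :=
  ⟨fun c a b => induction_on₂ a b
    (isClosed_eq ((continuous_const_smul c).comp continuous_mul)
      (continuous_fst.mul ((continuous_const_smul c).comp continuous_snd)))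
    fun a b => by
      rw [smul_eq_mul, smul_eq_mul, ← of_smul, ← of_mul, ← of_mul, ← of_smul, mul_smul_comm]⟩

instance : Star N.Completion :=
  ⟨UniformSpace.Completion.map (fun a : N.Space => star a)⟩

lemma of_star (a : A) : N.of (star a) = star (N.of a) :=
  (UniformSpace.Completion.map_coe (f := fun a : N.Space => star a)
    (star_isometry (E := N.Space)).uniformContinuous a).symm

lemma continuous_star' : Continuous fun x : N.Completion => star x :=
  UniformSpace.Completion.continuous_map (f := fun a : N.Space => star a)

instance : StarRing N.Completion where
  star_involutive a := induction_on a
    (isClosed_eq (N.continuous_star'.comp N.continuous_star') continuous_id)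
    fun a => by rw [← of_star, ← of_star, star_star]
  star_mul a b := induction_on₂ a b
    (isClosed_eq (N.continuous_star'.comp continuous_mul)
      ((N.continuous_star'.comp continuous_snd).mul (N.continuous_star'.comp continuous_fst)))
    fun a b => by rw [← of_mul, ← of_star, ← of_star, ← of_star, ← of_mul, star_mul]
  star_add a b := induction_on₂ a b
    (isClosed_eq (N.continuous_star'.comp continuous_add)
      ((N.continuous_star'.comp continuous_fst).add (N.continuous_star'.comp continuous_snd)))
    fun a b => by rw [← of_add, ← of_star, ← of_star, ← of_star, ← of_add, star_add]

instance : NormedStarGroup N.Completion where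
  norm_star_le a := induction_on a
    (isClosed_le (N.continuous_star'.norm) continuous_norm)
    fun a => by rw [← of_star, norm_of, norm_of, star_eq]

instance [StarModule ℂ A] : StarModule ℂ N.Completion where
  star_smul c a := induction_on a
    (isClosed_eq (N.continuous_star'.comp (continuous_const_smul c))
      ((continuous_const_smul (star c)).comp N.continuous_star'))
    fun a => by rw [← of_smul, ← of_star, ← of_star, ← of_smul, star_smul]

lemma cstarRing (h : N.IsCStar) : CStarRing N.Completion where
  norm_mul_self_le a := induction_on a
    (isClosed_le (by fun_prop) ((N.continuous_star'.mul continuous_id).norm))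
    fun a => by rw [← of_star, ← of_mul, norm_of, norm_of]; exact h a

end space

end StarSeminorm

/-! Enveloping C*-algebra -/

section envelope

/-- A `*`-representation of `B` on a complex Hilbert space. Hilbert spaces in the universe of `B`
are enough to compute norms: `‖π b‖` is the supremum of the norms of `π b` on the cyclic
subspaces, each of which has a dense subset that is an image of `B` (or of a countable set). -/
structure StarRep (B : Type u) [NonUnitalNormedRing B] [NormedSpace ℂ B] [StarRing B] where
  H : Type u
  [nacg : NormedAddCommGroup H]
  [ips : InnerProductSpace ℂ H]
  [complete : CompleteSpace H]
  π : B →⋆ₙₐ[ℂ] (H →L[ℂ] H)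

attribute [instance] StarRep.nacg StarRep.ips StarRep.complete

/-- The seminorm `a ↦ ‖π a‖` of a `*`-homomorphism to the bounded operators on a Hilbert space. -/
def StarSeminorm.ofHom {A : Type*} [NonUnitalRing A] [Module ℂ A] [StarRing A]
    {H : Type*} [NormedAddCommGroup H] [InnerProductSpace ℂ H] [CompleteSpace H]
    (π : A →⋆ₙₐ[ℂ] (H →L[ℂ] H)) : StarSeminorm A where
  toFun a := ‖π a‖
  map_zero' := by simp
  add_le' a b := by rw [map_add]; exact norm_add_le _ _
  neg' a := by rw [map_neg, norm_neg]
  smul' c a := by rw [map_smul, norm_smul]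
  mul_le' a b := by rw [map_mul]; exact norm_mul_le _ _
  star_le' a := by rw [map_star, norm_star]

lemma StarSeminorm.isCStar_ofHom {A : Type*} [NonUnitalRing A] [Module ℂ A] [StarRing A]
    {H : Type*} [NormedAddCommGroup H] [InnerProductSpace ℂ H] [CompleteSpace H]
    (π : A →⋆ₙₐ[ℂ] (H →L[ℂ] H)) : (StarSeminorm.ofHom π).IsCStar := fun a => by
  change ‖π a‖ * ‖π a‖ ≤ ‖π (star a * a)‖
  rw [map_mul, map_star, CStarRing.norm_star_mul_self]

variable {B : Type u} [NonUnitalNormedRing B] [NormedSpace ℂ B] [IsScalarTower ℂ B B]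
  [SMulCommClass ℂ B B] [StarRing B] [StarModule ℂ B] [NormedStarGroup B] [CompleteSpace B]

/-- `*`-representations of Banach `*`-algebras are contractive. -/
lemma StarRep.norm_le (π : StarRep B) (b : B) : ‖π.π b‖ ≤ ‖b‖ := by
  let φ : WithLp 1 (Unitization ℂ B) →ₐ[ℂ] (π.H →L[ℂ] π.H) :=
    (Unitization.lift (π.π : B →ₙₐ[ℂ] (π.H →L[ℂ] π.H))).comp
      (WithLp.unitizationAlgEquiv (R := ℂ) (𝕜 := ℂ) (A := B)).toAlgHom
  have key : ∀ x : B, IsSelfAdjoint x → ‖π.π x‖ ≤ ‖x‖ := by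
    intro x hx
    let y : WithLp 1 (Unitization ℂ B) := WithLp.toLp 1 (x : Unitization ℂ B)
    have hy : φ y = π.π x := by
      simp [φ, y]
      rfl
    have hny : ‖y‖₊ = ‖x‖₊ := by
      ext
      simp [y, WithLp.unitization_norm_def]
    have hone : NormOneClass (WithLp 1 (Unitization ℂ B)) :=
      ⟨by
        have h : WithLp.ofLp (1 : WithLp 1 (Unitization ℂ B)) = 1 := rfl
        rw [WithLp.unitization_norm_def, h]
        simp⟩
    have hs : IsSelfAdjoint (π.π x) := hx.map π.π
    have h1 : spectralRadius ℂ (φ y) ≤ ‖y‖₊ :=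
      (iSup_le_iSup_of_subset (AlgHom.spectrum_apply_subset φ y)).trans
        (spectrum.spectralRadius_le_nnnorm y)
    rw [hy, hs.spectralRadius_eq_nnnorm, hny] at h1
    exact_mod_cast h1
  have h2 : ‖π.π b‖ * ‖π.π b‖ ≤ ‖b‖ * ‖b‖ := by
    rw [← CStarRing.norm_star_mul_self (x := π.π b), ← map_star, ← map_mul]
    refine (key _ (IsSelfAdjoint.star_mul_self b)).trans ((norm_mul_le _ _).trans ?_)
    rw [norm_star]
  exact abs_le_of_sq_le_sq' (by simpa [sq] using h2) (norm_nonneg _) |>.2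

variable (B) in
/-- The seminorm `sup ‖π(b)‖` over all `*`-representations `π` of `B`. -/
def envSeminorm : StarSeminorm B :=
  StarSeminorm.sup (fun π : StarRep B => StarSeminorm.ofHom π.π)
    (fun b => ⟨‖b‖, by rintro _ ⟨π, rfl⟩; exact π.norm_le b⟩)

variable (B) in
/-- The enveloping `C^*`-algebra `C^*(B)` of a Banach `*`-algebra `B`: the Hausdorff completion of
`B` in the largest `C^*`-seminorm `envSeminorm B`. -/
abbrev CStarEnv : Type u := (envSeminorm B).Completion

lemma envSeminorm_isCStar : (envSeminorm B).IsCStar :=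
  StarSeminorm.isCStar_sup _ _ fun π => StarSeminorm.isCStar_ofHom π.π

instance : CStarRing (CStarEnv B) := StarSeminorm.cstarRing _ envSeminorm_isCStar

end envelope

end completions

section main

variable {G : Type u} [Group G] [TopologicalSpace G] [IsTopologicalGroup G]
  [LocallyCompactSpace G] [MeasurableSpace G] [BorelSpace G]
variable (μ : Measure G) [μ.IsHaarMeasure] [μ.Regular]

/-! Duality -/
section dual

/-- Complex conjugation on `L^p`. -/
def cj {p : ℝ≥0∞} (g : Lp ℂ p μ) : Lp ℂ p μ := (Lp.memLp g).star.toLp (star g)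

lemma coeFn_cj {p : ℝ≥0∞} (g : Lp ℂ p μ) : cj μ g =ᵐ[μ] fun s => (starRingEnd ℂ) (g s) :=
  (Lp.memLp g).star.coeFn_toLp

lemma norm_cj {p : ℝ≥0∞} (g : Lp ℂ p μ) : ‖cj μ g‖ = ‖g‖ := by
  rw [cj, Lp.norm_toLp, Lp.norm_def]
  congr 1
  exact eLpNorm_congr_norm_ae (Eventually.of_forall fun s => by simp)

variable (p q : ℝ≥0∞) [Fact (1 ≤ p)] [Fact (1 ≤ q)] [ENNReal.HolderConjugate p q]

lemma norm_pair_le (g : Lp ℂ p μ) (h : Lp ℂ q μ) : ‖pair μ p q g h‖ ≤ ‖g‖ * ‖h‖ := by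
  have h1 := ContinuousLinearMap.coeFn_holder (r := 1) (ContinuousLinearMap.mul ℂ ℂ) g h
  have h2 := ContinuousLinearMap.norm_holder_apply_apply_le (r := 1)
    (ContinuousLinearMap.mul ℂ ℂ) g h
  rw [ContinuousLinearMap.opNorm_mul, one_mul] at h2
  refine le_trans ?_ h2
  rw [pair_apply, norm_L1]
  refine (norm_integral_le_integral_norm _).trans (le_of_eq (integral_congr_ae ?_))
  filter_upwards [h1] with s hs
  rw [hs]
  rfl

lemma pair_leftReg (hp : p ≠ ∞) (hq : q ≠ ∞) (s : G) (g : Lp ℂ p μ) (h : Lp ℂ q μ) :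
    pair μ p q ((leftReg μ p hp).toHom s⁻¹ g) h
      = (starRingEnd ℂ) (pair μ p q (cj μ g) ((leftReg μ q hq).toHom s (cj μ h))) := by
  rw [pair_apply, pair_apply, ← integral_conj, ← integral_mul_left_eq_self _ s⁻¹]
  refine integral_congr_ae ?_
  have m := (measurePreserving_mul_left μ s⁻¹).quasiMeasurePreserving
  filter_upwards [m.ae (leftReg_apply μ p hp s⁻¹ g), coeFn_cj μ g, leftReg_apply μ q hq s (cj μ h),
    m.ae (coeFn_cj μ h)] with t h1 h2 h3 h4
  rw [h1, h2, h3, h4]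
  simp

lemma pair_lam_star (hp : p ≠ ∞) (hq : q ≠ ∞) (f : GroupL1 μ) (g : Lp ℂ p μ) (h : Lp ℂ q μ) :
    pair μ p q (lam μ p (GroupL1.toLp μ (star f)) g) h
      = (starRingEnd ℂ) (pair μ p q (cj μ g) (lam μ q (GroupL1.toLp μ f) (cj μ h))) := by
  rw [lam_eq μ p hp, lam_eq μ q hq, BanachRep.integrated_apply, BanachRep.integrated_apply]
  have h1 := ContinuousLinearMap.integral_comp_comm ((pair μ p q).flip h)
    ((leftReg μ p hp).integrable μ (L1.integrable_coeFn (GroupL1.toLp μ (star f))) g)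
  have h2 := ContinuousLinearMap.integral_comp_comm (pair μ p q (cj μ g))
    ((leftReg μ q hq).integrable μ (L1.integrable_coeFn (GroupL1.toLp μ f)) (cj μ h))
  refine h1.symm.trans (Eq.trans ?_ (congrArg (starRingEnd ℂ) h2))
  simp only [ContinuousLinearMap.flip_apply, map_smul, smul_eq_mul]
  rw [← integral_conj]
  have h3 := integral_starFn_mul μ (GroupL1.toLp μ f)
    (fun s => pair μ p q ((leftReg μ p hp).toHom s g) h)
  simp only [pair_leftReg μ p q hp hq] at h3
  simp only [map_mul]
  rw [← h3]
  refine integral_congr_ae ?_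
  filter_upwards [GroupL1.coeFn_star μ f] with s hs
  rw [hs]

lemma norm_le_of_pair (hp : p ≠ ∞) (hq : q ≠ ∞) (k : Lp ℂ p μ) {C : ℝ} (hC : 0 ≤ C)
    (h : ∀ h : Lp ℂ q μ, ‖pair μ p q k h‖ ≤ C * ‖h‖) : ‖k‖ ≤ C := by
  have hc : p.toReal.HolderConjugate q.toReal := ENNReal.HolderConjugate.toReal_of_ne_top hp hq
  set P := p.toReal with hP
  have hP1 : 0 < P - 1 := hc.sub_one_pos
  have hp0 : p ≠ 0 := ENNReal.HolderConjugate.ne_zero p q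
  have hq0 : q ≠ 0 := ENNReal.HolderConjugate.ne_zero q p
  -- the dual function
  set w : G → ℂ := fun s => (starRingEnd ℂ) (k s) * ((‖k s‖ ^ (P - 2) : ℝ) : ℂ) with hw
  have hwn : ∀ s, ‖w s‖ = ‖k s‖ ^ (P - 1) := by
    intro s
    rw [hw, norm_mul, RCLike.norm_conj, Complex.norm_real,
      Real.norm_of_nonneg (Real.rpow_nonneg (norm_nonneg _) _)]
    rcases eq_or_ne (‖k s‖) 0 with h0 | h0
    · rw [h0, zero_mul, Real.zero_rpow hP1.ne']
    · have : P - 1 = 1 + (P - 2) := by ring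
      rw [this, Real.rpow_add (lt_of_le_of_ne (norm_nonneg _) (Ne.symm h0)), Real.rpow_one]
  have hkm : AEMeasurable k μ := (Lp.aestronglyMeasurable k).aemeasurable
  have hwm : AEStronglyMeasurable w μ := by
    have h1 : AEMeasurable (fun s => (starRingEnd ℂ) (k s)) μ :=
      Complex.continuous_conj.measurable.comp_aemeasurable hkm
    have h2 : AEMeasurable (fun s => ((‖k s‖ ^ (P - 2) : ℝ) : ℂ)) μ :=
      Complex.measurable_ofReal.comp_aemeasurable (hkm.norm.pow_const _)
    exact (h1.mul h2).aestronglyMeasurable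
  have hexp : q * ENNReal.ofReal (P - 1) = p := by
    rw [← ENNReal.ofReal_toReal hq, ← ENNReal.ofReal_mul ENNReal.toReal_nonneg,
      ← ENNReal.ofReal_toReal hp]
    congr 1
    have := hc.mul_eq_add
    rw [mul_sub, mul_one, mul_comm, this]
    ring
  have hwe : eLpNorm w q μ = eLpNorm k p μ ^ (P - 1) := by
    have h1 : eLpNorm w q μ = eLpNorm (fun s => ‖k s‖ ^ (P - 1)) q μ :=
      eLpNorm_congr_norm_ae (Eventually.of_forall fun s => by
        rw [hwn, Real.norm_of_nonneg (Real.rpow_nonneg (norm_nonneg _) _)])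
    rw [h1, eLpNorm_norm_rpow _ hP1, hexp]
  have hwL : MemLp w q μ :=
    ⟨hwm, by rw [hwe]; exact ENNReal.rpow_lt_top_of_nonneg hP1.le (Lp.eLpNorm_ne_top k)⟩
  have hwN : ‖hwL.toLp w‖ = ‖k‖ ^ (P - 1) := by
    rw [Lp.norm_toLp, hwe, ← ENNReal.toReal_rpow, Lp.norm_def]
  have hI : 0 ≤ ∫ s, ‖k s‖ ^ P ∂μ := integral_nonneg fun s => Real.rpow_nonneg (norm_nonneg _) _
  have hkN : ∫ s, ‖k s‖ ^ P ∂μ = ‖k‖ ^ P := by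
    rw [Lp.norm_def, (Lp.memLp k).eLpNorm_eq_integral_rpow_norm hp0 hp,
      ENNReal.toReal_ofReal (Real.rpow_nonneg hI _), ← Real.rpow_mul hI,
      inv_mul_cancel₀ hc.ne_zero, Real.rpow_one]
  have hpair : pair μ p q k (hwL.toLp w) = ((∫ s, ‖k s‖ ^ P ∂μ : ℝ) : ℂ) := by
    rw [pair_apply, ← integral_complex_ofReal]
    refine integral_congr_ae ?_
    filter_upwards [hwL.coeFn_toLp] with s hs
    rw [hs, hw]
    simp only
    rw [← mul_assoc, Complex.mul_conj, ← Complex.ofReal_mul, Complex.normSq_eq_norm_sq]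
    congr 1
    rcases eq_or_ne (‖k s‖) 0 with h0 | h0
    · rw [h0, Real.zero_rpow hc.ne_zero]; simp
    · have h2 : P = 2 + (P - 2) := by ring
      conv_rhs => rw [h2, Real.rpow_add (lt_of_le_of_ne (norm_nonneg _) (Ne.symm h0))]
      rw [Real.rpow_two]
  have h1 := h (hwL.toLp w)
  rw [hpair, Complex.norm_real, Real.norm_of_nonneg hI, hkN, hwN] at h1
  rcases eq_or_ne ‖k‖ 0 with h0 | h0
  · rw [h0]; exact hC
  · have hpos : 0 < ‖k‖ := lt_of_le_of_ne (norm_nonneg _) (Ne.symm h0)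
    have h2 : ‖k‖ ^ P = ‖k‖ * ‖k‖ ^ (P - 1) := by
      conv_lhs => rw [show P = 1 + (P - 1) by ring, Real.rpow_add hpos, Real.rpow_one]
    rw [h2] at h1
    exact le_of_mul_le_mul_right h1 (Real.rpow_pos_of_pos hpos _)

lemma norm_lam_star_le (hp : p ≠ ∞) (hq : q ≠ ∞) (f : GroupL1 μ) :
    ‖lam μ p (GroupL1.toLp μ (star f))‖ ≤ ‖lam μ q (GroupL1.toLp μ f)‖ := by
  refine ContinuousLinearMap.opNorm_le_bound _ (norm_nonneg _) fun g => ?_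
  refine norm_le_of_pair μ p q hp hq _ (by positivity) fun h => ?_
  rw [pair_lam_star μ p q hp hq, RCLike.norm_conj]
  calc _ ≤ ‖cj μ g‖ * ‖lam μ q (GroupL1.toLp μ f) (cj μ h)‖ := norm_pair_le μ p q _ _
    _ ≤ ‖cj μ g‖ * (‖lam μ q (GroupL1.toLp μ f)‖ * ‖cj μ h‖) := by
      gcongr; exact ContinuousLinearMap.le_opNorm _ _
    _ = _ := by rw [norm_cj, norm_cj]; ring

end dual

lemma norm_lam_top (f : Lp ℂ 1 μ) : ‖lam μ ∞ f‖ = ‖f‖ := by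
  refine le_antisymm (norm_lam_le μ ∞ f) ?_
  set g : G → ℂ := fun r => (starRingEnd ℂ) (f r⁻¹) / (‖f r⁻¹‖ : ℂ) with hg
  have hgb : ∀ r, ‖g r‖ ≤ 1 := fun r => by
    rw [hg, norm_div, RCLike.norm_conj, Complex.norm_real, norm_norm]
    exact div_self_le_one _
  have hfm : AEMeasurable (fun r => f r⁻¹) μ :=
    ((Lp.aestronglyMeasurable f).comp_quasiMeasurePreserving
      (quasiMeasurePreserving_inv' μ)).aemeasurable
  have hgm : AEStronglyMeasurable g μ :=
    ((Complex.continuous_conj.measurable.comp_aemeasurable hfm).div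
      (Complex.measurable_ofReal.comp_aemeasurable hfm.norm)).aestronglyMeasurable
  have hgL : MemLp g ∞ μ := memLp_top_of_bound hgm 1 (Eventually.of_forall hgb)
  have hgN : ‖hgL.toLp g‖ ≤ 1 := by
    rw [Lp.norm_toLp, eLpNorm_exponent_top]
    refine ENNReal.toReal_le_of_le_ofReal zero_le_one
      (eLpNormEssSup_le_of_ae_bound (Eventually.of_forall hgb))
  have hv : conv μ f (hgL.toLp g) 1 = (‖f‖ : ℂ) := by
    rw [conv_congr μ (EventuallyEq.refl _ _) hgL.coeFn_toLp, norm_L1, conv,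
      ← integral_complex_ofReal]
    refine integral_congr_ae (Eventually.of_forall fun s => ?_)
    simp only [hg, mul_one, inv_inv]
    rw [← mul_div_assoc, Complex.mul_conj, Complex.normSq_eq_norm_sq, ← Complex.ofReal_div]
    congr 1
    rw [sq, mul_self_div_self]
  have hc := continuous_conv_top μ f (hgL.toLp g)
  have hae : ∀ᵐ t ∂μ, ‖conv μ f (hgL.toLp g) t‖ ≤ ‖lam μ ∞ f (hgL.toLp g)‖ := by
    have h1 := ae_bound_top μ (lam μ ∞ f (hgL.toLp g)) 1
    have h2 : ∀ᵐ s ∂μ, ‖lam μ ∞ f (hgL.toLp g) s‖ ≤ ‖lam μ ∞ f (hgL.toLp g)‖ := by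
      have := (quasiMeasurePreserving_inv' μ).ae h1
      simpa using this
    filter_upwards [h2, (memLp_conv μ ∞ f (hgL.toLp g)).coeFn_toLp] with t h3 h4
    rw [lam_apply, h4] at h3
    exact h3
  have hcl : IsClosed {t | ‖conv μ f (hgL.toLp g) t‖ ≤ ‖lam μ ∞ f (hgL.toLp g)‖} :=
    isClosed_le hc.norm continuous_const
  have huniv := (Measure.dense_of_ae hae).closure_eq
  rw [hcl.closure_eq] at huniv
  have h1 : ‖conv μ f (hgL.toLp g) 1‖ ≤ ‖lam μ ∞ f (hgL.toLp g)‖ := by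
    have : (1 : G) ∈ {t | ‖conv μ f (hgL.toLp g) t‖ ≤ ‖lam μ ∞ f (hgL.toLp g)‖} := by
      rw [huniv]; trivial
    exact this
  rw [hv, Complex.norm_real, norm_norm] at h1
  refine h1.trans ((ContinuousLinearMap.le_opNorm _ _).trans ?_)
  exact mul_le_of_le_one_right (norm_nonneg _) hgN

lemma max_lam_one (p q : ℝ≥0∞) [Fact (1 ≤ p)] [Fact (1 ≤ q)] [ENNReal.HolderConjugate p q]
    (h : p = ∞ ∨ q = ∞) (f : GroupL1 μ) :
    max ‖lam μ p (GroupL1.toLp μ f)‖ ‖lam μ q (GroupL1.toLp μ f)‖ = ‖f‖ := by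
  have h1 : ‖GroupL1.toLp μ f‖ = ‖f‖ := rfl
  rcases h with rfl | rfl
  · rw [norm_lam_top, max_eq_left (norm_lam_le μ q _), h1]
  · rw [norm_lam_top, max_eq_right (norm_lam_le μ p _), h1]

/-- The norm `‖f‖_{PF_p^*} = max (‖λ_p(f)‖, ‖λ_q(f)‖)` on `L¹(G)`, with `1/p + 1/q = 1`. -/
def pfSeminorm (p : ℝ≥0∞) [Fact (1 ≤ p)] : StarSeminorm (GroupL1 μ) where
  toFun f := max ‖lam μ p (GroupL1.toLp μ f)‖ ‖lam μ p.conjExponent (GroupL1.toLp μ f)‖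
  map_zero' := by
    have : GroupL1.toLp μ 0 = 0 := rfl
    simp [this]
  add_le' f g := by
    have : GroupL1.toLp μ (f + g) = GroupL1.toLp μ f + GroupL1.toLp μ g := rfl
    rw [this, map_add, map_add]
    exact max_le ((norm_add_le _ _).trans (add_le_add (le_max_left _ _) (le_max_left _ _)))
      ((norm_add_le _ _).trans (add_le_add (le_max_right _ _) (le_max_right _ _)))
  neg' f := by
    have : GroupL1.toLp μ (-f) = -GroupL1.toLp μ f := rfl
    rw [this, map_neg, map_neg, norm_neg, norm_neg]
  smul' c f := by
    have : GroupL1.toLp μ (c • f) = c • GroupL1.toLp μ f := rfl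
    rw [this, map_smul, map_smul, norm_smul, norm_smul, mul_max_of_nonneg _ _ (norm_nonneg c)]
  mul_le' f g := by
    by_cases h : p = ∞ ∨ p.conjExponent = ∞
    · rw [max_lam_one μ _ _ h, max_lam_one μ _ _ h, max_lam_one μ _ _ h]
      exact norm_mul_le f g
    · obtain ⟨hp, hq⟩ := not_or.1 h
      rw [GroupL1.lam_mul μ hp, GroupL1.lam_mul μ hq]
      refine max_le ((norm_mul_le _ _).trans ?_) ((norm_mul_le _ _).trans ?_)
      · exact mul_le_mul (le_max_left _ _) (le_max_left _ _) (norm_nonneg _)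
          (le_max_of_le_left (norm_nonneg _))
      · exact mul_le_mul (le_max_right _ _) (le_max_right _ _) (norm_nonneg _)
          (le_max_of_le_left (norm_nonneg _))
  star_le' f := by
    by_cases h : p = ∞ ∨ p.conjExponent = ∞
    · rw [max_lam_one μ _ _ h, max_lam_one μ _ _ h, norm_star]
    · obtain ⟨hp, hq⟩ := not_or.1 h
      exact max_le ((norm_lam_star_le μ _ _ hp hq f).trans (le_max_right _ _))
        ((norm_lam_star_le μ _ _ hq hp f).trans (le_max_left _ _))

/-! Unitary representations -/

/-- A (strongly continuous) unitary representation of `G` on a complex Hilbert space. Hilbert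
spaces in the universe of `G` are enough: if `⟨π(s)ξ, ξ⟩` is an `L^p` function of `s`, so are the
coefficients of all vectors in the span of the orbit of `ξ`, so the norm of an
`L^p`-representation is the supremum over its cyclic `L^p`-subrepresentations. -/
structure UnitaryRep (G : Type u) [Group G] [TopologicalSpace G] where
  H : Type u
  [nacg : NormedAddCommGroup H]
  [ips : InnerProductSpace ℂ H]
  [complete : CompleteSpace H]
  π : G →* unitary (H →L[ℂ] H)
  cont : ∀ ξ : H, Continuous fun s => (π s : H →L[ℂ] H) ξ

attribute [instance] UnitaryRep.nacg UnitaryRep.ips UnitaryRep.complete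

namespace UnitaryRep

/-- The matrix coefficient `s ↦ ⟨π(s)ξ, η⟩`, linear in `ξ`. -/
def coeff (π : UnitaryRep G) (ξ η : π.H) (s : G) : ℂ := inner ℂ η ((π.π s : π.H →L[ℂ] π.H) ξ)

/-- `π` is an `L^p`-representation: there is a dense subspace `H₀` with `⟨π(s)ξ, ξ⟩ ∈ L^p(G)` for
every `ξ ∈ H₀`. -/
def IsLp (π : UnitaryRep G) (μ : Measure G) (p : ℝ≥0∞) : Prop :=
  ∃ H₀ : Submodule ℂ π.H, Dense (H₀ : Set π.H) ∧ ∀ ξ ∈ H₀, MemLp (π.coeff ξ ξ) p μ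

lemma norm_apply (π : UnitaryRep G) (s : G) (ξ : π.H) : ‖(π.π s : π.H →L[ℂ] π.H) ξ‖ = ‖ξ‖ :=
  ContinuousLinearMap.norm_map_of_mem_unitary (π.π s).2 ξ

/-- The underlying Banach representation. -/
def toBanachRep (π : UnitaryRep G) : BanachRep G π.H where
  toHom := (unitary (π.H →L[ℂ] π.H)).subtype.comp π.π
  norm_le s x := (π.norm_apply s x).le
  cont := π.cont

/-- The integrated form `π(f) = ∫ f(s) π(s) ds` on `L¹(G)`. -/
def integrated (π : UnitaryRep G) : GroupL1 μ →⋆ₙₐ[ℂ] (π.H →L[ℂ] π.H) where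
  toFun f := π.toBanachRep.integrated μ (GroupL1.toLp μ f)
  map_smul' c f := map_smul (π.toBanachRep.integrated μ) c (GroupL1.toLp μ f)
  map_zero' := map_zero (π.toBanachRep.integrated μ)
  map_add' f g := map_add (π.toBanachRep.integrated μ) (GroupL1.toLp μ f) (GroupL1.toLp μ g)
  map_mul' f g := by
    ext1 x
    rw [GroupL1.mul_def, lam_eq μ 1 ENNReal.one_ne_top]
    exact BanachRep.integrated_integrated μ _ _ _ _
  map_star' f := by
    rw [ContinuousLinearMap.star_eq_adjoint, ContinuousLinearMap.eq_adjoint_iff]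
    intro x y
    rw [BanachRep.integrated_apply, BanachRep.integrated_apply]
    have i1 := π.toBanachRep.integrable μ (L1.integrable_coeFn (GroupL1.toLp μ (star f))) x
    have i2 := π.toBanachRep.integrable μ (L1.integrable_coeFn (GroupL1.toLp μ f)) y
    rw [← inner_conj_symm, ← integral_inner i1, ← integral_inner i2, ← integral_conj]
    have hinv : ∀ s, inner ℂ y (π.toBanachRep.toHom s⁻¹ x)
        = (starRingEnd ℂ) (inner ℂ x (π.toBanachRep.toHom s y)) := fun s => by
      have : π.toBanachRep.toHom s⁻¹ = ContinuousLinearMap.adjoint (π.toBanachRep.toHom s) := by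
        change ((π.π s⁻¹ : unitary (π.H →L[ℂ] π.H)) : π.H →L[ℂ] π.H) = star (π.π s : π.H →L[ℂ] π.H)
        rw [map_inv]; rfl
      rw [this, ContinuousLinearMap.adjoint_inner_right, inner_conj_symm]
    have h3 := integral_starFn_mul μ (GroupL1.toLp μ f)
      (fun s => inner ℂ y (π.toBanachRep.toHom s x))
    simp only [hinv] at h3
    have h4 := congrArg (starRingEnd ℂ) h3
    rw [← integral_conj, ← integral_conj] at h4
    simp only [inner_smul_right, map_mul, RCLike.conj_conj] at h4 ⊢
    rw [← h4]
    refine integral_congr_ae ?_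
    filter_upwards [GroupL1.coeFn_star μ f] with s hs
    rw [hs]

lemma integrated_apply (π : UnitaryRep G) (f : GroupL1 μ) (ξ : π.H) :
    π.integrated μ f ξ = ∫ s, GroupL1.toLp μ f s • (π.π s : π.H →L[ℂ] π.H) ξ ∂μ := rfl

lemma norm_integrated_le (π : UnitaryRep G) (f : GroupL1 μ) : ‖π.integrated μ f‖ ≤ ‖f‖ :=
  BanachRep.norm_integrated_le _ μ _

end UnitaryRep

/-- `‖f‖ = sup ‖π(f)‖` over all `L^p`-representations `π`. -/
def lpSeminorm (p : ℝ≥0∞) : StarSeminorm (GroupL1 μ) :=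
  StarSeminorm.sup (fun π : {π : UnitaryRep G // π.IsLp μ p} =>
      StarSeminorm.ofHom (π.1.integrated μ))
    (fun f => ⟨‖f‖, by rintro _ ⟨π, rfl⟩; exact π.1.norm_integrated_le μ f⟩)

/-- The symmetrized algebra of `p`-pseudofunctions `PF_p^*(G)`, the completion of `L¹(G)` in the
norm `pfSeminorm`. -/
abbrev PFStar (p : ℝ≥0∞) [Fact (1 ≤ p)] : Type u := (pfSeminorm μ p).Completion

/-- The `C^*`-algebra `C^*_{L^p}(G)`, the completion of `L¹(G)` in the norm `lpSeminorm`. -/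
abbrev CStarLp (p : ℝ≥0∞) : Type u := (lpSeminorm μ p).Completion

lemma lpSeminorm_isCStar (p : ℝ≥0∞) : (lpSeminorm μ p).IsCStar :=
  StarSeminorm.isCStar_sup _ _ fun π => StarSeminorm.isCStar_ofHom (π.1.integrated μ)

instance (p : ℝ≥0∞) : CStarRing (CStarLp μ p) :=
  StarSeminorm.cstarRing _ (lpSeminorm_isCStar μ p)

instance (p : ℝ≥0∞) : NonUnitalCStarAlgebra (CStarLp μ p) where
instance (p : ℝ≥0∞) [Fact (1 ≤ p)] : NonUnitalCStarAlgebra (CStarEnv (PFStar μ p)) where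

end main

end GroupAlg
end

/-! Everything rests on the inequality `‖π(f)‖ ≤ ‖f‖_{PF_p^*}` for every `L^p`-representation `π`
and every `f ∈ L¹(G)`; it is `UnitaryRep.norm_integrated_le_pfSeminorm`. Write `q` for the conjugate
exponent of `p`.

Take `ξ` with `⟨π(·)ξ, ξ⟩ ∈ L^p` and `f ∈ L¹ ∩ L^q`, and put `F = f^* * f` and `T = π(F)`, a
self-adjoint operator. The convolution power `F^{*(n+1)}` is `λ_q(F)^n F`, so its `L^q` norm is at
most `‖λ_q(F)‖^n ‖F‖_q`, and Hölder's inequality gives `|⟨T^(n+1) ξ, ξ⟩| ≤ C ‖λ_q(F)‖^n` with `C =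
‖F‖_q ‖⟨π(·)ξ, ξ⟩‖_p` independent of `n`. For a self-adjoint operator the exponential rate of these
moments controls `‖T ξ‖`, and `C` drops out: `‖T ξ‖ ≤ ‖λ_q(F)‖ ‖ξ‖`
(`norm_apply_le_of_inner_pow_le`). Therefore `‖π(f)ξ‖² = ⟨T ξ, ξ⟩ ≤ ‖λ_q(f^* * f)‖ ‖ξ‖² ≤
‖f‖_{PF_p^*}² ‖ξ‖²`, the last step because the norm of `PF_p^*` is submultiplicative and invariant
under the involution. The resulting bound contains neither `‖f‖_q` nor the `L^p` norm of the
coefficient, so it passes to all `ξ` and all `f` by density of `H₀` in the Hilbert space and of the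
compactly supported continuous functions in `L¹`.

The inequality makes `PF_p^*(G) → C^*_{L^p}(G)` a contraction, with dense image because the image
contains that of `L¹(G)`. It also extends every `L^p`-representation to a `*`-representation of
`PF_p^*(G)`, so the norm of `C^*_{L^p}(G)` is dominated by the enveloping seminorm and the map
factors through `C^*(PF_p^*(G))`. The factored map is a `*`-homomorphism of `C^*`-algebras with
dense range, hence surjective (`surjective_of_denseRange`). -/

noncomputable section
namespace GroupAlg
open Measure Filter Topology
set_option linter.unusedSectionVars false

/-! `*`-homomorphisms of `C^*`-algebras have closed range -/

section closedRange

variable {A B : Type*} [NonUnitalCStarAlgebra A] [NonUnitalCStarAlgebra B]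

open NonUnitalIsometricContinuousFunctionalCalculus in
/-- A self-adjoint element in the range of a `*`-homomorphism lifts with the same norm. -/
lemma exists_map_eq_norm_le_of_isSelfAdjoint (φ : A →⋆ₙₐ[ℂ] B) {a : A} (ha : IsSelfAdjoint a) :
    ∃ a' : A, φ a' = φ a ∧ ‖a'‖ ≤ ‖φ a‖ := by
  have hφ : Continuous φ :=
    AddMonoidHomClass.continuous_of_bound φ 1 fun x => by
      simpa using NonUnitalStarAlgHom.norm_apply_le φ x
  set r := ‖φ a‖ with hr
  have hr0 : 0 ≤ r := norm_nonneg _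
  -- Truncation to `[-r, r]`. The lift is `h(a)`: its norm is at most `r`, and `φ (h(a)) = h(φ a) =
  -- φ a` because the quasispectrum of `φ a` lies in `[-r, r]`, where `h` is the identity. The
  -- non-unital calculus requires `h 0 = 0`.
  let h : ℝ → ℝ := fun t => max (-r) (min t r)
  have h0 : h 0 = 0 := by simp [h, hr0]
  have hc : Continuous h := by fun_prop
  have hφa : IsSelfAdjoint (φ a) := ha.map φ
  refine ⟨cfcₙ h a, ?_, norm_cfcₙ_le fun x _ => ?_⟩
  · rw [NonUnitalStarAlgHomClass.map_cfcₙ (S := ℂ) φ h a hc.continuousOn h0 hφ ha hφa]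
    conv_rhs => rw [← cfcₙ_id ℝ (φ a) hφa]
    refine cfcₙ_congr fun x hx => ?_
    have hx' : |x| ≤ r := norm_quasispectrum_le (φ a) hx hφa
    obtain ⟨h1, h2⟩ := abs_le.1 hx'
    simp [h, h1, h2]
  · rw [Real.norm_eq_abs, abs_le]
    exact ⟨le_max_left _ _, max_le (by linarith) (min_le_right _ _)⟩

/-- The real and imaginary parts are lifted separately, each with norm at most `‖φ a‖`; this is the
source of the constant `2`. It is not sharp, but any uniform constant is enough for the closed range
argument. -/
lemma exists_map_eq_norm_le (φ : A →⋆ₙₐ[ℂ] B) (a : A) :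
    ∃ a' : A, φ a' = φ a ∧ ‖a'‖ ≤ 2 * ‖φ a‖ := by
  obtain ⟨x, hx, hxn⟩ := exists_map_eq_norm_le_of_isSelfAdjoint φ (realPart a).2
  obtain ⟨y, hy, hyn⟩ := exists_map_eq_norm_le_of_isSelfAdjoint φ (imaginaryPart a).2
  have h1 : ‖φ (realPart a : A)‖ ≤ ‖φ a‖ := by
    rw [map_realPart φ a]
    exact realPart.norm_le (φ a)
  have h2 : ‖φ (imaginaryPart a : A)‖ ≤ ‖φ a‖ := by
    rw [map_imaginaryPart φ a]
    exact imaginaryPart.norm_le (φ a)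
  refine ⟨x + Complex.I • y, ?_, ?_⟩
  · rw [map_add, map_smul, hx, hy, ← map_smul, ← map_add, realPart_add_I_smul_imaginaryPart]
  · refine (norm_add_le _ _).trans ?_
    rw [norm_smul, Complex.norm_I, one_mul]
    linarith

/-- A `*`-homomorphism of `C^*`-algebras with dense range is surjective. -/
lemma surjective_of_denseRange (φ : A →⋆ₙₐ[ℂ] B) (h : DenseRange φ) : Function.Surjective φ := by
  let F : NormedAddGroupHom A B := (φ : A →+ B).mkNormedAddGroupHom 1 fun x => by
    simpa using NonUnitalStarAlgHom.norm_apply_le φ x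
  have hF : F.SurjectiveOnWith F.range 2 := by
    rintro _ ⟨a, rfl⟩
    exact exists_map_eq_norm_le φ a
  -- An element of the closure of the range is the sum of a rapidly convergent series in the range.
  -- Lifting its terms with norm control gives a series that converges in the complete space `A`, so
  -- the closure of the range is attained.
  have := controlled_closure_of_complete two_pos one_pos hF
  intro b
  obtain ⟨a, ha, -⟩ := this b (by
    have : b ∈ closure (Set.range φ) := h b
    exact this)
  exact ⟨a, ha⟩

end closedRange

/-! Extension of `*`-homomorphisms to completions -/

namespace StarSeminorm

variable {A : Type u} [NonUnitalRing A] [Module ℂ A] [StarRing A] (N : StarSeminorm A)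
  {C : Type*} [NonUnitalNormedRing C] [NormedSpace ℂ C] [StarRing C] [NormedStarGroup C]
  [CompleteSpace C]

/-- A `*`-homomorphism dominated by a seminorm extends to the completion. -/
def lift (φ : A →⋆ₙₐ[ℂ] C) : N.Completion → C :=
  UniformSpace.Completion.extension (α := N.Space) (fun a : N.Space => φ a)

variable {N} {φ : A →⋆ₙₐ[ℂ] C} (h : ∀ a, ‖φ a‖ ≤ N a)

/-- `UniformSpace.Completion.extension` is continuous for every function, its default on functions
that are not uniformly continuous being a constant map. The bound `h` first enters in `lift_of`. -/
lemma continuous_lift : Continuous (N.lift φ) :=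
  UniformSpace.Completion.continuous_extension

include h

lemma lift_of (a : A) : N.lift φ (N.of a) = φ a := by
  refine UniformSpace.Completion.extension_coe (α := N.Space) (f := fun a : N.Space => φ a) ?_ a
  let f : N.Space →+ C :=
    { toFun := fun a => φ a, map_zero' := map_zero φ, map_add' := map_add φ }
  exact AddMonoidHomClass.uniformContinuous_of_bound f 1 fun x => by
    rw [one_mul]; exact h x

lemma norm_lift_le (x : N.Completion) : ‖N.lift φ x‖ ≤ ‖x‖ :=
  induction_on x (isClosed_le continuous_lift.norm continuous_norm) fun a => by
    rw [lift_of h, norm_of]; exact h a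

/-- `lift` as a `*`-homomorphism. -/
def liftHom : N.Completion →⋆ₙₐ[ℂ] C where
  toFun := N.lift φ
  map_smul' c x := induction_on x
    (isClosed_eq (continuous_lift.comp (continuous_const_smul c))
      (continuous_lift.const_smul c)) fun a => by
      rw [← of_smul, lift_of h, lift_of h, map_smul]; rfl
  map_zero' := by rw [← of_zero, lift_of h, map_zero]
  map_add' x y := induction_on₂ x y
    (isClosed_eq (continuous_lift.comp continuous_add)
      ((continuous_lift.comp continuous_fst).add (continuous_lift.comp continuous_snd)))
    fun a b => by rw [← of_add, lift_of h, lift_of h, lift_of h, map_add]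
  map_mul' x y := induction_on₂ x y
    (isClosed_eq (continuous_lift.comp continuous_mul)
      ((continuous_lift.comp continuous_fst).mul (continuous_lift.comp continuous_snd)))
    fun a b => by rw [← of_mul, lift_of h, lift_of h, lift_of h, map_mul]
  map_star' x := induction_on x
    (isClosed_eq (continuous_lift.comp N.continuous_star')
      (continuous_star.comp continuous_lift))
    fun a => by rw [← of_star, lift_of h, lift_of h, map_star]

lemma liftHom_of (a : A) : liftHom h (N.of a) = φ a := lift_of h a

lemma norm_liftHom_le (x : N.Completion) : ‖liftHom h x‖ ≤ ‖x‖ := norm_lift_le h x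

lemma continuous_liftHom : Continuous (liftHom h) := continuous_lift

omit h in
variable (N) in
/-- The canonical map into the completion, as a `*`-homomorphism. -/
def ofStarHom : A →⋆ₙₐ[ℂ] N.Completion where
  toFun := N.of
  map_smul' := N.of_smul
  map_zero' := N.of_zero
  map_add' := N.of_add
  map_mul' := N.of_mul
  map_star' := N.of_star

end StarSeminorm

/-! Powers of a self-adjoint operator -/

section hilbert

variable {H : Type*} [NormedAddCommGroup H] [InnerProductSpace ℂ H] [CompleteSpace H]

/-- One of the two factors `T ^ 2 ^ n` moves across the inner product. This turns control of the
diagonal moments of `T` into control of vector norms. -/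
lemma norm_sq_pow_apply_of_isSelfAdjoint {T : H →L[ℂ] H} (hT : IsSelfAdjoint T) (ξ : H) (n : ℕ) :
    ‖(T ^ 2 ^ n) ξ‖ ^ 2 = ‖inner ℂ ξ ((T ^ 2 ^ (n + 1)) ξ)‖ := by
  have h : inner ℂ ((T ^ 2 ^ n) ξ) ((T ^ 2 ^ n) ξ) = inner ℂ ξ ((T ^ 2 ^ (n + 1)) ξ) := by
    rw [← ContinuousLinearMap.adjoint_inner_right, ← ContinuousLinearMap.star_eq_adjoint,
      (hT.pow (2 ^ n)).star_eq, ← mul_apply_eq_comp, ← pow_add, pow_succ, mul_two]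
  rw [← h, inner_self_eq_norm_sq_to_K, norm_pow, RCLike.norm_ofReal, abs_norm]

/-- Log-convexity of the norms `‖T ^ k ξ‖` along powers of two: each doubling squares the previous
estimate and applies Cauchy–Schwarz to `⟨ξ, T ^ 2 ^ (n + 1) ξ⟩`. It says that if `‖T ξ‖` is large
compared with `‖ξ‖`, the iterates must grow at least geometrically. -/
lemma norm_pow_apply_le_of_isSelfAdjoint {T : H →L[ℂ] H} (hT : IsSelfAdjoint T) (ξ : H) (n : ℕ) :
    ‖T ξ‖ ^ (2 ^ n) ≤ ‖ξ‖ ^ (2 ^ n - 1) * ‖(T ^ (2 ^ n)) ξ‖ := by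
  induction n with
  | zero => simp
  | succ n ih =>
    have h1 : ‖(T ^ (2 ^ n)) ξ‖ ^ 2 ≤ ‖ξ‖ * ‖(T ^ (2 ^ (n + 1))) ξ‖ := by
      rw [norm_sq_pow_apply_of_isSelfAdjoint hT]
      exact norm_inner_le_norm (𝕜 := ℂ) ξ ((T ^ 2 ^ (n + 1)) ξ)
    have hk : 1 ≤ 2 ^ n := Nat.one_le_two_pow
    calc ‖T ξ‖ ^ (2 ^ (n + 1)) = (‖T ξ‖ ^ (2 ^ n)) ^ 2 := by rw [← pow_mul, pow_succ]
      _ ≤ (‖ξ‖ ^ (2 ^ n - 1) * ‖(T ^ (2 ^ n)) ξ‖) ^ 2 := by gcongr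
      _ = ‖ξ‖ ^ ((2 ^ n - 1) * 2) * ‖(T ^ (2 ^ n)) ξ‖ ^ 2 := by rw [mul_pow, ← pow_mul]
      _ ≤ ‖ξ‖ ^ ((2 ^ n - 1) * 2) * (‖ξ‖ * ‖(T ^ (2 ^ (n + 1))) ξ‖) := by gcongr
      _ = ‖ξ‖ ^ (2 ^ (n + 1) - 1) * ‖(T ^ (2 ^ (n + 1))) ξ‖ := by
        rw [← mul_assoc, ← pow_succ]
        congr 2
        rw [pow_succ]
        omega

/-- The growth of `⟨T ^ n ξ, ξ⟩` bounds `‖T ξ‖`. -/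
lemma norm_apply_le_of_inner_pow_le {T : H →L[ℂ] H} (hT : IsSelfAdjoint T) (ξ : H) {C r : ℝ}
    (hr : 0 ≤ r) (h : ∀ n : ℕ, ‖inner ℂ ξ ((T ^ (n + 1)) ξ)‖ ≤ C * r ^ n) :
    ‖T ξ‖ ≤ r * ‖ξ‖ := by
  rcases eq_or_ne ξ 0 with rfl | hξ
  · simp
  have hM : 0 < ‖ξ‖ := norm_pos_iff.2 hξ
  have hC : 0 ≤ C := by simpa using (norm_nonneg _).trans (h 0)
  -- Comparing with an arbitrary `s > r * ‖ξ‖` replaces `r` by `x = s / ‖ξ‖ > r`, which is positive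
  -- even when `r = 0` and can be divided by.
  refine le_of_forall_gt_imp_ge_of_dense fun s hs => ?_
  set x := s / ‖ξ‖ with hx
  have hrx : r < x := by rwa [hx, lt_div_iff₀ hM]
  have hx0 : 0 < x := hr.trans_lt hrx
  have hsx : s = x * ‖ξ‖ := by rw [hx, div_mul_cancel₀ _ hM.ne']
  by_contra! hlt
  rw [hsx] at hlt
  set y := ‖T ξ‖ / (x * ‖ξ‖) with hy
  have hy1 : 1 < y := by rwa [hy, one_lt_div (by positivity)]
  -- If `‖T ξ‖ > s`, then `y > 1`, while the growth hypothesis keeps all the powers `y ^ (2 ^ (n +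
  -- 1))` below a constant that does not depend on `n`, a contradiction.
  have key : ∀ n : ℕ, y ^ (2 ^ (n + 1)) ≤ C / (x * ‖ξ‖ ^ 2) := by
    intro n
    have hk : 1 ≤ 2 ^ n := Nat.one_le_two_pow
    have h1 : ‖(T ^ (2 ^ n)) ξ‖ ^ 2 ≤ C * x ^ (2 ^ (n + 1) - 1) := by
      -- The moment of order `2 ^ (n + 1)` is the hypothesis at index `2 ^ (n + 1) - 1`; the missing
      -- factor of `x` is why `x` remains in the denominator of `key`.
      have h3 := h (2 ^ (n + 1) - 1)
      rw [Nat.sub_add_cancel Nat.one_le_two_pow, ← norm_sq_pow_apply_of_isSelfAdjoint hT] at h3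
      exact h3.trans (by gcongr)
    have h4 := norm_pow_apply_le_of_isSelfAdjoint hT ξ n
    rw [hy, div_pow, div_le_div_iff₀ (by positivity) (by positivity)]
    calc ‖T ξ‖ ^ (2 ^ (n + 1)) * (x * ‖ξ‖ ^ 2)
        = (‖T ξ‖ ^ (2 ^ n)) ^ 2 * (x * ‖ξ‖ ^ 2) := by rw [← pow_mul, pow_succ]
      _ ≤ (‖ξ‖ ^ (2 ^ n - 1) * ‖(T ^ (2 ^ n)) ξ‖) ^ 2 * (x * ‖ξ‖ ^ 2) := by gcongr
      _ = (‖ξ‖ ^ (2 ^ n - 1) * ‖ξ‖) ^ 2 * x * ‖(T ^ (2 ^ n)) ξ‖ ^ 2 := by ring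
      _ ≤ (‖ξ‖ ^ (2 ^ n - 1) * ‖ξ‖) ^ 2 * x * (C * x ^ (2 ^ (n + 1) - 1)) := by gcongr
      _ = C * ((‖ξ‖ ^ (2 ^ n - 1) * ‖ξ‖) ^ 2 * (x ^ (2 ^ (n + 1) - 1) * x)) := by ring
      _ = C * (x * ‖ξ‖) ^ (2 ^ (n + 1)) := by
        rw [pow_sub_one_mul (by positivity), pow_sub_one_mul (by positivity), mul_pow, ← pow_mul,
          ← pow_succ, mul_comm (‖ξ‖ ^ _)]
  obtain ⟨m, hm⟩ := pow_unbounded_of_one_lt (C / (x * ‖ξ‖ ^ 2)) hy1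
  refine (hm.trans_le ?_).not_ge (key m)
  refine pow_le_pow_right₀ hy1.le ?_
  exact (Nat.le_succ m).trans Nat.lt_two_pow_self.le

end hilbert

/-! `L^p`-representations and convolution operators -/

section lpRep

variable {G : Type u} [Group G] [TopologicalSpace G] [IsTopologicalGroup G]
  [LocallyCompactSpace G] [MeasurableSpace G] [BorelSpace G]
variable (μ : Measure G) [μ.IsHaarMeasure] [μ.Regular]

/-- The inner product, linear in its second variable, passes under the Bochner integral. Diagonal
entries of `π(f)` thereby become pairings of `f` with a coefficient, to which Hölder applies. -/
lemma UnitaryRep.inner_integrated (π : UnitaryRep G) (f : GroupL1 μ) (ξ : π.H) :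
    inner ℂ ξ (π.integrated μ f ξ) = ∫ s, GroupL1.toLp μ f s * π.coeff ξ ξ s ∂μ := by
  have h := integral_inner (𝕜 := ℂ)
    (π.toBanachRep.integrable μ (L1.integrable_coeFn (GroupL1.toLp μ f)) ξ) ξ
  simp only [inner_smul_right] at h
  exact h.symm

/-- Hölder's inequality for diagonal coefficients. -/
lemma UnitaryRep.norm_inner_integrated_le (π : UnitaryRep G) (p q : ℝ≥0∞) [Fact (1 ≤ p)]
    [Fact (1 ≤ q)] [ENNReal.HolderConjugate q p] {ξ : π.H} (hξ : MemLp (π.coeff ξ ξ) p μ)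
    (f : GroupL1 μ) (g : Lp ℂ q μ) (hfg : GroupL1.toLp μ f =ᵐ[μ] g) :
    ‖inner ℂ ξ (π.integrated μ f ξ)‖ ≤ ‖g‖ * ‖hξ.toLp‖ := by
  refine le_of_eq_of_le (congrArg _ ?_) (norm_pair_le μ q p g hξ.toLp)
  rw [π.inner_integrated μ, pair_apply]
  refine integral_congr_ae ?_
  filter_upwards [hfg, hξ.coeFn_toLp] with s h1 h2
  rw [h1, h2]

/-- Convolution powers of a function in `L¹ ∩ L^q`. -/
lemma exists_conv_pow (π : UnitaryRep G) (q : ℝ≥0∞) [Fact (1 ≤ q)] (f : GroupL1 μ)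
    (g : Lp ℂ q μ) (hfg : GroupL1.toLp μ f =ᵐ[μ] g) (n : ℕ) :
    ∃ (k : GroupL1 μ) (l : Lp ℂ q μ), GroupL1.toLp μ k =ᵐ[μ] l ∧
      π.integrated μ k = π.integrated μ f ^ (n + 1) ∧
      ‖l‖ ≤ ‖lam μ q (GroupL1.toLp μ f)‖ ^ n * ‖g‖ := by
  induction n with
  | zero => exact ⟨f, g, hfg, by simp, by simp⟩
  | succ n ih =>
    obtain ⟨k, l, hkl, hk, hl⟩ := ih
    -- `k` and `l` are the same convolution power of `f`, seen in `L¹` and in `L^q`. Convolving by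
    -- `f` on the left acts on `l` as `λ_q(f)`, so each step costs one factor `‖λ_q(f)‖`, and the
    -- first power costs only `‖g‖`.
    refine ⟨f * k, lam μ q (GroupL1.toLp μ f) l, ?_, ?_, ?_⟩
    · rw [lam_apply]
      refine (GroupL1.coeFn_mul μ f k).trans ?_
      rw [conv_congr μ (EventuallyEq.refl _ _) hkl]
      exact (memLp_conv μ q _ l).coeFn_toLp.symm
    · rw [map_mul, hk, ← pow_succ']
    · refine (ContinuousLinearMap.le_opNorm _ _).trans ?_
      rw [pow_succ', mul_assoc]
      gcongr

variable (p : ℝ≥0∞) [Fact (1 ≤ p)]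

/-- Continuity is for the `L¹` norm, in which `λ_p` and `λ_q` are bounded linear maps. It lets
estimates pass from compactly supported continuous functions to all of `L¹`. -/
lemma continuous_pfSeminorm : Continuous fun f : GroupL1 μ => pfSeminorm μ p f := by
  have h1 : Continuous fun f : Lp ℂ 1 μ => max ‖lam μ p f‖ ‖lam μ p.conjExponent f‖ := by fun_prop
  exact h1

/-- The estimate on functions of `L¹ ∩ L^q` and vectors with `L^p` coefficients. -/
lemma UnitaryRep.norm_integrated_apply_le_of_memLp (π : UnitaryRep G) {ξ : π.H}
    (hξ : MemLp (π.coeff ξ ξ) p μ) (f : GroupL1 μ)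
    (hf : MemLp (GroupL1.toLp μ f) p.conjExponent μ) :
    ‖π.integrated μ f ξ‖ ≤ pfSeminorm μ p f * ‖ξ‖ := by
  have hpq : ENNReal.HolderConjugate p.conjExponent p :=
    (ENNReal.HolderConjugate.conjExponent (Fact.out : 1 ≤ p)).symm
  -- Passing to `f^* * f` makes the operator self-adjoint. It stays in `L¹ ∩ L^q`, with `L^q` class
  -- `λ_q(f^*) f`.
  set F : GroupL1 μ := star f * f with hF
  set g := lam μ p.conjExponent (GroupL1.toLp μ (star f)) hf.toLp with hg
  have hFg : GroupL1.toLp μ F =ᵐ[μ] g := by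
    rw [hg, lam_apply]
    refine (GroupL1.coeFn_mul μ _ _).trans ?_
    rw [← conv_congr μ (EventuallyEq.refl _ _) hf.coeFn_toLp]
    exact (memLp_conv μ _ _ hf.toLp).coeFn_toLp.symm
  set T := π.integrated μ F with hT
  have hTf : T = star (π.integrated μ f) * π.integrated μ f := by rw [hT, hF, map_mul, map_star]
  have hTs : IsSelfAdjoint T := by rw [hTf]; exact IsSelfAdjoint.star_mul_self _
  have h1 : ‖T ξ‖ ≤ ‖lam μ p.conjExponent (GroupL1.toLp μ F)‖ * ‖ξ‖ := by
    -- All dependence on the `L^q` norm of `F` and the `L^p` norm of the coefficient is put in `C`,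
    -- which does not affect the conclusion; only the rate `‖λ_q(F)‖` survives.
    refine norm_apply_le_of_inner_pow_le hTs ξ (C := ‖g‖ * ‖hξ.toLp‖) (norm_nonneg _) fun n => ?_
    obtain ⟨k, l, hkl, hk, hl⟩ := exists_conv_pow μ π p.conjExponent F g hFg n
    rw [hT, ← hk]
    refine (π.norm_inner_integrated_le μ p p.conjExponent hξ k l hkl).trans ?_
    calc ‖l‖ * ‖hξ.toLp‖
        ≤ (‖lam μ p.conjExponent (GroupL1.toLp μ F)‖ ^ n * ‖g‖) * ‖hξ.toLp‖ := by gcongr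
      _ = _ := by ring
  -- The symmetrized norm is needed here: the involution exchanges the roles of `λ_p` and `λ_q`, so
  -- it is the maximum of the two norms that is invariant under `star`.
  have h2 : ‖lam μ p.conjExponent (GroupL1.toLp μ F)‖ ≤ pfSeminorm μ p f * pfSeminorm μ p f :=
    calc _ ≤ pfSeminorm μ p F := le_max_right _ _
      _ ≤ pfSeminorm μ p (star f) * pfSeminorm μ p f := (pfSeminorm μ p).mul_le _ _
      _ = _ := by rw [(pfSeminorm μ p).star_eq]
  have h3 : inner ℂ (π.integrated μ f ξ) (π.integrated μ f ξ) = inner ℂ ξ (T ξ) := by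
    rw [hTf, mul_apply_eq_comp, ContinuousLinearMap.star_eq_adjoint,
      ContinuousLinearMap.adjoint_inner_right]
  have h4 : ‖π.integrated μ f ξ‖ ^ 2 ≤ ‖ξ‖ * ‖T ξ‖ := by
    have := norm_inner_le_norm (𝕜 := ℂ) ξ (T ξ)
    rwa [← h3, inner_self_eq_norm_sq_to_K, norm_pow, RCLike.norm_ofReal, abs_norm] at this
  have h5 : 0 ≤ pfSeminorm μ p f := apply_nonneg _ _
  refine le_of_sq_le_sq ?_ (by positivity)
  calc ‖π.integrated μ f ξ‖ ^ 2 ≤ ‖ξ‖ * ‖T ξ‖ := h4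
    _ ≤ ‖ξ‖ * ((pfSeminorm μ p f * pfSeminorm μ p f) * ‖ξ‖) := by
      gcongr
      exact h1.trans (by gcongr)
    _ = _ := by ring

/-- The integrated form of an `L^p`-representation is dominated by the norm of `PF_p^*(G)`. -/
lemma UnitaryRep.norm_integrated_le_pfSeminorm (π : UnitaryRep G) (hπ : π.IsLp μ p)
    (f : GroupL1 μ) : ‖π.integrated μ f‖ ≤ pfSeminorm μ p f := by
  obtain ⟨H₀, hd, hH⟩ := hπ
  have h0 : 0 ≤ pfSeminorm μ p f := apply_nonneg _ _
  refine ContinuousLinearMap.opNorm_le_bound _ h0 fun ξ => ?_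
  -- For fixed `f` the estimate is a closed condition on `ξ`, so vectors of `H₀` suffice.
  refine hd.induction (P := fun ξ => ‖π.integrated μ f ξ‖ ≤ pfSeminorm μ p f * ‖ξ‖) ?_
    (isClosed_le (by fun_prop) (by fun_prop)) ξ
  intro ξ hξ
  -- For fixed `ξ` it is also closed in `f` for the `L¹` norm. Compactly supported continuous
  -- functions are dense in `L¹` and lie in `L^q`, whatever `q` is.
  have hcl : IsClosed {f : GroupL1 μ | ‖π.integrated μ f ξ‖ ≤ pfSeminorm μ p f * ‖ξ‖} := by
    refine isClosed_le ?_ ((continuous_pfSeminorm μ p).mul continuous_const)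
    exact (((π.toBanachRep.integrated μ).flip ξ).continuous).norm
  refine hcl.closure_subset_iff.2 ?_ (mem_closure_ccSub μ 1 ENNReal.one_ne_top (GroupL1.toLp μ f))
  rintro _ ⟨g, hg, hg', rfl⟩
  exact π.norm_integrated_apply_le_of_memLp μ p (hH ξ hξ) _
    ((memLp_congr_ae (memLp_of_cc μ hg hg').coeFn_toLp).2 (memLp_of_cc μ hg hg'))

lemma lpSeminorm_le_pfSeminorm (f : GroupL1 μ) : lpSeminorm μ p f ≤ pfSeminorm μ p f :=
  Real.iSup_le (fun π => π.1.norm_integrated_le_pfSeminorm μ p π.2 f) (apply_nonneg _ _)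

/-- The canonical map `PF_p^*(G) → C^*_{L^p}(G)`. -/
def pfToCStarLp : PFStar μ p →⋆ₙₐ[ℂ] CStarLp μ p :=
  StarSeminorm.liftHom (N := pfSeminorm μ p) (φ := (lpSeminorm μ p).ofStarHom) fun f => by
    change ‖(lpSeminorm μ p).of f‖ ≤ _
    rw [StarSeminorm.norm_of]
    exact lpSeminorm_le_pfSeminorm μ p f

lemma pfToCStarLp_of (f : GroupL1 μ) :
    pfToCStarLp μ p ((pfSeminorm μ p).of f) = (lpSeminorm μ p).of f :=
  StarSeminorm.liftHom_of _ f

lemma norm_pfToCStarLp_le (x : PFStar μ p) : ‖pfToCStarLp μ p x‖ ≤ ‖x‖ :=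
  StarSeminorm.norm_liftHom_le _ x

lemma continuous_pfToCStarLp : Continuous (pfToCStarLp μ p) := StarSeminorm.continuous_liftHom _

/-- The extension of an `L^p`-representation to `PF_p^*(G)`. -/
def UnitaryRep.pfRep (π : UnitaryRep G) (hπ : π.IsLp μ p) : StarRep (PFStar μ p) where
  H := π.H
  π := StarSeminorm.liftHom (N := pfSeminorm μ p) (φ := π.integrated μ)
    (π.norm_integrated_le_pfSeminorm μ p hπ)

/-- Each `L^p`-representation extends to a `*`-representation of `PF_p^*(G)`, namely
`UnitaryRep.pfRep`, and so takes part in the supremum that defines the enveloping seminorm. -/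
lemma lpSeminorm_le_envSeminorm (f : GroupL1 μ) :
    lpSeminorm μ p f ≤ envSeminorm (PFStar μ p) ((pfSeminorm μ p).of f) := by
  refine Real.iSup_le (fun π => ?_) (apply_nonneg _ _)
  have h : ‖(π.1.pfRep μ p π.2).π ((pfSeminorm μ p).of f)‖ = ‖π.1.integrated μ f‖ :=
    congrArg norm (StarSeminorm.liftHom_of (π.1.norm_integrated_le_pfSeminorm μ p π.2) f)
  refine h.symm.trans_le ?_
  exact le_ciSup (f := fun σ : StarRep (PFStar μ p) => ‖σ.π ((pfSeminorm μ p).of f)‖)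
    ⟨_, by rintro _ ⟨σ, rfl⟩; exact σ.norm_le _⟩ (π.1.pfRep μ p π.2)

end lpRep

/-! ### Continuity of the enveloping seminorm -/

section envelope

variable {B : Type u} [NonUnitalNormedRing B] [NormedSpace ℂ B] [IsScalarTower ℂ B B]
  [SMulCommClass ℂ B B] [StarRing B] [StarModule ℂ B] [NormedStarGroup B] [CompleteSpace B]

lemma envSeminorm_le_norm (b : B) : envSeminorm B b ≤ ‖b‖ :=
  Real.iSup_le (fun π => π.norm_le b) (norm_nonneg b)

/-- A seminorm dominated by the norm is 1-Lipschitz; the domination is the contractivity of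
`*`-representations of a Banach `*`-algebra. -/
lemma continuous_envSeminorm : Continuous fun b : B => envSeminorm B b := by
  refine LipschitzWith.continuous (K := 1) (LipschitzWith.of_dist_le_mul fun a b => ?_)
  rw [NNReal.coe_one, one_mul, Real.dist_eq, dist_eq_norm]
  exact (abs_sub_map_le_sub (envSeminorm B).toSeminorm a b).trans (envSeminorm_le_norm _)

end envelope

/-! ### Factorization through the enveloping C*-algebra, and surjectivity -/

section extension

variable {G : Type u} [Group G] [TopologicalSpace G] [IsTopologicalGroup G]
  [LocallyCompactSpace G] [MeasurableSpace G] [BorelSpace G]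
variable (μ : Measure G) [μ.IsHaarMeasure] [μ.Regular] (p : ℝ≥0∞) [Fact (1 ≤ p)]

/-- Both sides are continuous on `PF_p^*(G)`, so `lpSeminorm_le_envSeminorm` on the dense image of
`L¹(G)` is enough. This is the bound that lets `pfToCStarLp` descend to the completion in the
enveloping seminorm. -/
lemma norm_pfToCStarLp_le_envSeminorm (x : PFStar μ p) :
    ‖pfToCStarLp μ p x‖ ≤ envSeminorm (PFStar μ p) x :=
  StarSeminorm.induction_on (N := pfSeminorm μ p) x
    (isClosed_le (continuous_pfToCStarLp μ p).norm continuous_envSeminorm) fun f => by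
      rw [pfToCStarLp_of, StarSeminorm.norm_of]
      exact lpSeminorm_le_envSeminorm μ p f

/-- The canonical map `C^*(PF_p^*(G)) → C^*_{L^p}(G)`. -/
def envToCStarLp : CStarEnv (PFStar μ p) →⋆ₙₐ[ℂ] CStarLp μ p :=
  StarSeminorm.liftHom (norm_pfToCStarLp_le_envSeminorm μ p)

lemma envToCStarLp_of_of (f : GroupL1 μ) :
    envToCStarLp μ p ((envSeminorm (PFStar μ p)).of ((pfSeminorm μ p).of f))
      = (lpSeminorm μ p).of f :=
  (StarSeminorm.liftHom_of (norm_pfToCStarLp_le_envSeminorm μ p) _).trans (pfToCStarLp_of μ p f)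

lemma denseRange_pfToCStarLp : DenseRange (pfToCStarLp μ p) :=
  (lpSeminorm μ p).denseRange_of.mono (by rintro _ ⟨f, rfl⟩; exact ⟨_, pfToCStarLp_of μ p f⟩)

/-- The range contains the image of `L¹(G)`, hence is dense; since source and target are both
C*-algebras, it is also closed. -/
lemma surjective_envToCStarLp : Function.Surjective (envToCStarLp μ p) :=
  surjective_of_denseRange _
    ((lpSeminorm μ p).denseRange_of.mono (by rintro _ ⟨f, rfl⟩; exact ⟨_, envToCStarLp_of_of μ p f⟩))

end extension

end GroupAlg
end

theorem mainTheorem7 {G : Type u} [Group G] [TopologicalSpace G] [IsTopologicalGroup G]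
    [LocallyCompactSpace G] [T2Space G] [MeasurableSpace G] [BorelSpace G]
    (μ : Measure G) [μ.IsHaarMeasure] [μ.Regular]
    (p : ℝ≥0∞) [Fact (1 ≤ p)] (hp : 2 ≤ p) :
    (∃ Φ : GroupAlg.PFStar μ p →⋆ₙₐ[ℂ] GroupAlg.CStarLp μ p,
      (∀ f : GroupAlg.GroupL1 μ,
        Φ ((GroupAlg.pfSeminorm μ p).of f) = (GroupAlg.lpSeminorm μ p).of f) ∧
      (∀ x, ‖Φ x‖ ≤ ‖x‖) ∧ DenseRange Φ) ∧
    (∃ Ψ : GroupAlg.CStarEnv (GroupAlg.PFStar μ p) →⋆ₙₐ[ℂ] GroupAlg.CStarLp μ p,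
      (∀ f : GroupAlg.GroupL1 μ,
        Ψ ((GroupAlg.envSeminorm (GroupAlg.PFStar μ p)).of ((GroupAlg.pfSeminorm μ p).of f))
          = (GroupAlg.lpSeminorm μ p).of f) ∧
      Function.Surjective Ψ) :=
  ⟨⟨GroupAlg.pfToCStarLp μ p, GroupAlg.pfToCStarLp_of μ p, GroupAlg.norm_pfToCStarLp_le μ p,
      GroupAlg.denseRange_pfToCStarLp μ p⟩,
    ⟨GroupAlg.envToCStarLp μ p, GroupAlg.envToCStarLp_of_of μ p,
      GroupAlg.surjective_envToCStarLp μ p⟩⟩
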